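/- **Setting.** Let $k,m\ge 1$ ($k$ fast and $m=n-k$ slow variables), $\mu\in\mathbb R$, $\varepsilon_1>0$, and let $a^L,a^R:[0,\varepsilon_1]\to\mathbb R^k$ and $b^L,b^R:[0,\varepsilon_1]\to\mathbb R^m$ be $C^1$. For $j\ge1$ let $e_1,\dots,e_j$ be the standard basis of $\mathbb R^j$ and $J_j=[\,0\ e_1\cdots e_{j-1}]$. For $\varepsilon\in[0,\varepsilon_1]$ consider the slow-fast observer canonical form for $z=(x,y)\in\mathbb R^k\times\mathbb R^m$: $$\dot x=(J_k-a^X(\varepsilon)e_1^{\mathsf T})x+e_k\,y_1,\qquad \dot y=\varepsilon\,g(x,y;\varepsilon),\qquad g(x,y;\varepsilon)=-b^X(\varepsilon)x_1+J_m y+e_m\mu,$$ with $X=L$ if $x_1\le 0$ and $X=R$ if $x_1\ge 0$. Let $\varphi_t(z;\varepsilon)$ be its flow, and put $A_X=J_k-a^X(0)e_1^{\mathsf T}$. The critical manifold $\mathcal M_0=\{(x,y): x=H(y_1)\}$ is given by $$H(y_1)=\frac{y_1}{a^X_k(0)}\,\bigl(1,\,a^X_1(0),\dots,a^X_{k-1}(0)\bigr)^{\mathsf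 T},\qquad X=L\text{ if }y_1\le0,\quad X=R\text{ if }y_1\ge0.$$ It is *globally stable* if all eigenvalues of $A_L$ and $A_R$ have negative real part and, for every fixed $y_1\in\mathbb R$, $H(y_1)$ is a globally asymptotically stable equilibrium (Lyapunov stable, with basin of attraction $\mathbb R^k$) of the layer equations $$\dot x=A_Xx+e_ky_1,\qquad X=L\text{ if }x_1\le0,\quad X=R\text{ if }x_1\ge0.$$ The reduced system on $\mathbb R^m$, in the slow time $\tau=\varepsilon t$, is $$\frac{dy}{d\tau}=g_0(y)=B_Xy+e_m\mu,\qquad B_X=J_m-\frac{b^X(0)}{a^X_k(0)}e_1^{\mathsf T},\qquad X=L\text{ if }y_1\le 0,\quad X=R\text{ if }y_1\ge0.$$ A *strong trapping region* for it is a compact set $\Omega\subset\mathbb R^m$ with smooth boundary (near each boundary point, $\Omega=\{h\le0\}$ for a $C^\infty$ function $h$ with $dh\ne0$ at that point) such that forward orbits starting in $\Omega$ stay in $\Omega$ and at no point of $\partial\Omega$ is $g_0$ tangent to $\partial\Omega$. For $\delta\ge0$ let $\Omega_\delta=\{(x,y):\|x-H(y_1)\|\le\delta,\ y\in\Omega\}$,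 with the Euclidean norm. **Theorem.** Suppose $\mathcal M_0$ is globally stable and $\Omega$ is a strong trapping region for the reduced system. Then there exist $M>0$, $N\ge M$, $\varepsilon_{\max}\in(0,\varepsilon_1]$ and $K\in\mathbb R$ such that for all $\varepsilon\in(0,\varepsilon_{\max})$: 1. for every $z\in\Omega_{\varepsilon M}$ the forward orbit $\varphi_t(z;\varepsilon)$ exists for all $t\ge0$, and $\varphi_t(z;\varepsilon)\in\Omega_{\varepsilon N}$ for all $t\ge0$; 2. there is a set $V$ with $\Omega_{\varepsilon M}\subseteq V\subseteq\Omega_{\varepsilon N}$ that is forward invariant under the flow $\varphi_t(\cdot;\varepsilon)$; 3. on $\Omega_{\varepsilon N}$ the slow dynamics $\frac{dy}{d\tau}=g(x,y;\varepsilon)$ is an $O(\varepsilon)$ perturbation of the reduced system: $\|g(x,y;\varepsilon)-g_0(y)\|\le K\varepsilon$ for all $(x,y)\in\Omega_{\varepsilon N}$. -/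

import Mathlib

open Set Filter Topology
open scoped ContDiff

noncomputable section

/-! ### Autonomous differential equations -/

/-- `z` restricted to `[0, ∞)` is a solution of `dz/dt = f z` (a forward orbit). -/
def IsForwardOrbit {E : Type*} [NormedAddCommGroup E] [NormedSpace ℝ E]
    (f : E → E) (z : ℝ → E) : Prop :=
  ∀ t : ℝ, 0 ≤ t → HasDerivWithinAt z (f (z t)) (Ici 0) t

/-- Every forward orbit that starts in `S` stays in `S`. -/
def IsForwardInvariantSet {E : Type*} [NormedAddCommGroup E] [NormedSpace ℝ E]
    (f : E → E) (S : Set E) : Prop :=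
  ∀ z : ℝ → E, IsForwardOrbit f z → z 0 ∈ S → ∀ t : ℝ, 0 ≤ t → z t ∈ S

/-- `p` is a globally asymptotically stable equilibrium of `dz/dt = f z`: it is an equilibrium,
it is Lyapunov stable, and its basin of attraction is the whole space. -/
structure IsGloballyAsymptoticallyStable {E : Type*} [NormedAddCommGroup E] [NormedSpace ℝ E]
    (f : E → E) (p : E) : Prop where
  equilibrium : f p = 0
  lyapunov : ∀ r : ℝ, 0 < r → ∃ δ : ℝ, 0 < δ ∧ ∀ z : ℝ → E, IsForwardOrbit f z →
    ‖z 0 - p‖ < δ → ∀ t : ℝ, 0 ≤ t → ‖z t - p‖ < r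
  attracting : ∀ z : ℝ → E, IsForwardOrbit f z → Tendsto z atTop (𝓝 p)

/-! ### Strong trapping regions -/

/-- `h` is a smooth local defining function, on the open set `U`, of the set `Ω` near `p`:
inside `U`, the set `Ω` is `{h ≤ 0}`, and `dh` does not vanish at `p`. -/
structure IsLocalDefiningFunction {E : Type*} [NormedAddCommGroup E] [NormedSpace ℝ E]
    (Ω : Set E) (p : E) (U : Set E) (h : E → ℝ) : Prop where
  isOpen : IsOpen U
  mem : p ∈ U
  smooth : ContDiffOn ℝ ∞ h U
  fderiv_ne : fderiv ℝ h p ≠ 0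
  inter_eq : Ω ∩ U = {q ∈ U | h q ≤ 0}

/-- The boundary of `Ω` is smooth. -/
def HasSmoothBoundary {E : Type*} [NormedAddCommGroup E] [NormedSpace ℝ E] (Ω : Set E) : Prop :=
  ∀ p ∈ frontier Ω, ∃ (U : Set E) (h : E → ℝ), IsLocalDefiningFunction Ω p U h

/-- The vector `v` is tangent to the boundary of `Ω` at the boundary point `p`, i.e. it lies in the
kernel of `dh` at `p` for a local defining function `h` (any two local defining functions at `p`
have the same kernel there). -/
def IsTangentToBoundary {E : Type*} [NormedAddCommGroup E] [NormedSpace ℝ E]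
    (Ω : Set E) (p v : E) : Prop :=
  ∃ (U : Set E) (h : E → ℝ), IsLocalDefiningFunction Ω p U h ∧ fderiv ℝ h p v = 0

/-- A strong trapping region of `dy/dτ = g y`: a compact set with smooth boundary, which forward
orbits do not leave, and such that `g` is nowhere tangent to the boundary. -/
structure IsStrongTrappingRegion {E : Type*} [NormedAddCommGroup E] [NormedSpace ℝ E]
    (g : E → E) (Ω : Set E) : Prop where
  isCompact : IsCompact Ω
  smoothBoundary : HasSmoothBoundary Ω
  trapping : IsForwardInvariantSet g Ω
  not_tangent : ∀ p ∈ frontier Ω, ¬ IsTangentToBoundary Ω p (g p)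

/-! ### Companion matrices -/

/-- The last index in `Fin k`. -/
def lastIdx (k : ℕ) [NeZero k] : Fin k := ⟨k - 1, Nat.sub_one_lt (NeZero.ne k)⟩

/-- The first standard basis vector `e_1` of `ℝ^k`. -/
def eFirst (k : ℕ) [NeZero k] : EuclideanSpace ℝ (Fin k) := EuclideanSpace.single 0 1

/-- The last standard basis vector `e_k` of `ℝ^k`. -/
def eLast (k : ℕ) [NeZero k] : EuclideanSpace ℝ (Fin k) := EuclideanSpace.single (lastIdx k) 1

/-- `J_k`, the matrix with columns `0, e_1, …, e_{k-1}` (ones on the superdiagonal). -/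
def shiftMatrix (k : ℕ) : Matrix (Fin k) (Fin k) ℝ :=
  Matrix.of fun i j => if i.val + 1 = j.val then 1 else 0

/-- The companion matrix `J_k - p e_1ᵀ`. -/
def companionMatrix {k : ℕ} [NeZero k] (p : EuclideanSpace ℝ (Fin k)) :
    Matrix (Fin k) (Fin k) ℝ :=
  shiftMatrix k - Matrix.vecMulVec p.ofLp (eFirst k).ofLp

/-- All complex eigenvalues of the real matrix `A` have negative real part. -/
def IsHurwitz {k : ℕ} (A : Matrix (Fin k) (Fin k) ℝ) : Prop :=
  ∀ z ∈ spectrum ℂ (A.map (fun r : ℝ => (r : ℂ))), z.re < 0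

/-! ### The slow-fast observer canonical form -/

/-- The data of a slow-fast observer canonical form with `k` fast and `m = n - k` slow variables:
the coefficient vectors `a^L, a^R ∈ ℝ^k` and `b^L, b^R ∈ ℝ^m`, as functions of `ε`,
and the parameter `μ`. -/
structure SFOCF (k m : ℕ) where
  aL : ℝ → EuclideanSpace ℝ (Fin k)
  aR : ℝ → EuclideanSpace ℝ (Fin k)
  bL : ℝ → EuclideanSpace ℝ (Fin m)
  bR : ℝ → EuclideanSpace ℝ (Fin m)
  μ : ℝ

namespace SFOCF

variable {k m : ℕ}

/-- The right-hand side of the system is a `C¹` function of `ε` on `[0, ε₁]`. -/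
structure IsC1On (S : SFOCF k m) (ε₁ : ℝ) : Prop where
  aL : ContDiffOn ℝ 1 S.aL (Icc 0 ε₁)
  aR : ContDiffOn ℝ 1 S.aR (Icc 0 ε₁)
  bL : ContDiffOn ℝ 1 S.bL (Icc 0 ε₁)
  bR : ContDiffOn ℝ 1 S.bR (Icc 0 ε₁)

variable [NeZero k] [NeZero m]

/-- `dx/dt`, as a function of `ε`, of the first slow variable `y₁`, and of `x`. -/
def fastField (S : SFOCF k m) (ε y₁ : ℝ) (x : EuclideanSpace ℝ (Fin k)) :
    EuclideanSpace ℝ (Fin k) :=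
  if x 0 ≤ 0 then Matrix.toEuclideanCLM (𝕜 := ℝ) (companionMatrix (S.aL ε)) x + y₁ • eLast k
  else Matrix.toEuclideanCLM (𝕜 := ℝ) (companionMatrix (S.aR ε)) x + y₁ • eLast k

/-- `dy/dτ = ε⁻¹ dy/dt`, as a function of `ε` and of `(x, y)`. -/
def slowField (S : SFOCF k m) (ε : ℝ)
    (z : EuclideanSpace ℝ (Fin k) × EuclideanSpace ℝ (Fin m)) : EuclideanSpace ℝ (Fin m) :=
  if z.1 0 ≤ 0 then
    -(z.1 0 • S.bL ε) + Matrix.toEuclideanCLM (𝕜 := ℝ) (shiftMatrix m) z.2 + S.μ • eLast m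
  else
    -(z.1 0 • S.bR ε) + Matrix.toEuclideanCLM (𝕜 := ℝ) (shiftMatrix m) z.2 + S.μ • eLast m

/-- The slow-fast observer canonical form `dz/dt = field ε z`, `z = (x, y)`. -/
def field (S : SFOCF k m) (ε : ℝ)
    (z : EuclideanSpace ℝ (Fin k) × EuclideanSpace ℝ (Fin m)) :
    EuclideanSpace ℝ (Fin k) × EuclideanSpace ℝ (Fin m) :=
  (S.fastField ε (z.2 0) z.1, ε • S.slowField ε z)

/-- The layer equations `dx/dt = layerField y₁ x`, for frozen `y₁`. -/
def layerField (S : SFOCF k m) (y₁ : ℝ) : EuclideanSpace ℝ (Fin k) → EuclideanSpace ℝ (Fin k) :=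
  S.fastField 0 y₁

/-- `(y₁ / a_k) (1, a_1, …, a_{k-1})`, which is `-A⁻¹ e_k y₁` for `A = J_k - a e_1ᵀ` with
`a_k ≠ 0`. -/
def branch (a : EuclideanSpace ℝ (Fin k)) (y₁ : ℝ) : EuclideanSpace ℝ (Fin k) :=
  WithLp.toLp 2 fun i : Fin k =>
    (y₁ / a (lastIdx k)) *
      (if i = 0 then 1 else a ⟨i.val - 1, lt_of_le_of_lt (Nat.sub_le _ _) i.isLt⟩)

/-- The equilibrium `H(y₁)` of the layer equations; the critical manifold `M₀` is
`{(x, y) | x = H(y₁)}`. -/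
def H (S : SFOCF k m) (y₁ : ℝ) : EuclideanSpace ℝ (Fin k) :=
  if y₁ ≤ 0 then branch (S.aL 0) y₁ else branch (S.aR 0) y₁

/-- The critical manifold is globally stable: `A_L` and `A_R` have all eigenvalues in the open
left half-plane, and for each `y₁` the point `H(y₁)` is a globally asymptotically stable
equilibrium of the layer equations. -/
structure IsGloballyStable (S : SFOCF k m) : Prop where
  hurwitzL : IsHurwitz (companionMatrix (S.aL 0))
  hurwitzR : IsHurwitz (companionMatrix (S.aR 0))
  stable : ∀ y₁ : ℝ, IsGloballyAsymptoticallyStable (S.layerField y₁) (S.H y₁)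

/-- The reduced system `dy/dτ = reducedField y`, i.e. `dy/dτ = B_X y + μ e_m` with
`B_X = J_m - (b^X(0) / a^X_k(0)) e_1ᵀ`, where `X = L` if `y₁ ≤ 0` and `X = R` if `y₁ ≥ 0`. -/
def reducedField (S : SFOCF k m) (y : EuclideanSpace ℝ (Fin m)) : EuclideanSpace ℝ (Fin m) :=
  if y 0 ≤ 0 then
    Matrix.toEuclideanCLM (𝕜 := ℝ)
      (companionMatrix ((S.aL 0 (lastIdx k))⁻¹ • S.bL 0)) y + S.μ • eLast m
  else
    Matrix.toEuclideanCLM (𝕜 := ℝ)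
      (companionMatrix ((S.aR 0 (lastIdx k))⁻¹ • S.bR 0)) y + S.μ • eLast m

/-- `Ω_δ = {(x, y) | ‖x - H(y₁)‖ ≤ δ, y ∈ Ω}`. -/
def tube (S : SFOCF k m) (Ω : Set (EuclideanSpace ℝ (Fin m))) (δ : ℝ) :
    Set (EuclideanSpace ℝ (Fin k) × EuclideanSpace ℝ (Fin m)) :=
  {z | ‖z.1 - S.H (z.2 0)‖ ≤ δ ∧ z.2 ∈ Ω}

end SFOCF

end

/-! ### Forward orbits of Lipschitz fields: Grönwall comparison, uniqueness, global existence. -/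

section ForwardOrbits

variable {E : Type*} [NormedAddCommGroup E] [NormedSpace ℝ E]

/-! The layer flow contracts towards the critical manifold uniformly: there are `T` and `C` such
that every layer orbit has halved its distance to its equilibrium at time `T`, and never exceeds `C`
times its initial distance before that (`IsHomogeneousLayer.exists_uniform_contraction`). Attraction
alone gives no uniformity over an unbounded family. It comes from compactness after two
normalisations: the layer equations are positively homogeneous in `(y₁, x)`, and near `H (±1)`,
which lies off the switching plane because `a_k > 0`, they are linear, so small deviations can be
enlarged to a fixed size.

Over time `T` the slow variable moves by `O(ε)`, so Grönwall compares a slow-fast orbit with the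
layer orbit for frozen `y₁`. Its distance `d` to the critical manifold obeys `d(T) ≤ d(0)/2 + Dε`
and `d(t) ≤ C d(0) + Dε` in between (`SFOCF.exists_tube_estimates`). Hence `d ≤ εM` recurs at all
multiples of `T`, and `d < εN` holds throughout.

In that tube the slow velocity is `O(ε)`-close to the reduced field, which points strictly into `Ω`
on its boundary. By compactness, small perturbations of the field still cannot leave `Ω`
(`IsStrongTrappingRegion.exists_robust`). Each of the two bounds needs the other, so they are
propagated together by `forall_mem_of_continuation`. -/

theorem IsForwardOrbit.continuousOn {f : E → E} {z : ℝ → E} (hz : IsForwardOrbit f z) :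
    ContinuousOn z (Ici 0) :=
  fun t ht => (hz t ht).continuousWithinAt

theorem IsForwardOrbit.shift {f : E → E} {z : ℝ → E} (hz : IsForwardOrbit f z) {s : ℝ}
    (hs : 0 ≤ s) : IsForwardOrbit f fun t => z (s + t) := by
  intro t ht
  have h1 : HasDerivWithinAt (fun t : ℝ => s + t) 1 (Ici 0) t :=
    ((hasDerivAt_id t).const_add s).hasDerivWithinAt
  have h2 := HasDerivWithinAt.scomp (t' := Ici 0) t (hz (s + t) (by positivity)) h1
    (fun r (hr : 0 ≤ r) => by show 0 ≤ s + r; positivity)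
  simpa [Function.comp_def] using h2

/-- Grönwall's inequality for a Lipschitz field, with a constant that depends only on the
Lipschitz constant and on the length of the time interval. -/
theorem exists_dist_le_of_approx_orbit (K : NNReal) {T : ℝ} (hT : 0 ≤ T) :
    ∃ C : ℝ, 1 ≤ C ∧ ∀ {f : E → E}, LipschitzWith K f → ∀ {z w w' : ℝ → E} {η t : ℝ},
      0 ≤ η → t ∈ Icc 0 T → IsForwardOrbit f z →
      (∀ s ∈ Icc 0 t, HasDerivWithinAt w (w' s) (Ici 0) s) →
      (∀ s ∈ Icc 0 t, ‖w' s - f (w s)‖ ≤ η) → ‖z t - w t‖ ≤ C * (‖z 0 - w 0‖ + η) := by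
  -- The summand `1 + T` serves the case `K = 0`, where the Grönwall bound is affine in time; the
  -- exponentials serve `K ≠ 0`.
  refine ⟨1 + T + Real.exp (K * T) + Real.exp (K * T) / K, ?_, ?_⟩
  · have : 0 ≤ Real.exp (K * T) / K := by positivity
    have := Real.exp_pos (K * T)
    linarith
  intro f hf z w w' η t hη ht hz hw hη'
  have h1 := dist_le_of_approx_trajectories_ODE (v := fun _ => f) (K := K) (f := z) (g := w)
    (f' := fun t => f (z t)) (g' := w') (a := 0) (b := t) (εf := 0) (εg := η)
    (δ := ‖z 0 - w 0‖) (fun _ => hf)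
    (hz.continuousOn.mono fun s hs => hs.1)
    (fun s hs => (hz s hs.1).mono (Ici_subset_Ici.2 hs.1)) (fun s _ => by simp)
    (fun s hs => (hw s hs).continuousWithinAt.mono fun s hs => hs.1)
    (fun s hs => (hw s ⟨hs.1, hs.2.le⟩).mono (Ici_subset_Ici.2 hs.1))
    (fun s hs => by rw [dist_eq_norm]; exact hη' s ⟨hs.1, hs.2.le⟩)
    (by rw [dist_eq_norm]) t ⟨ht.1, le_rfl⟩
  rw [dist_eq_norm, zero_add, sub_zero] at h1
  refine h1.trans ((gronwallBound_mono (norm_nonneg _) hη K.coe_nonneg ht.2).trans ?_)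
  have hδ := norm_nonneg (z 0 - w 0)
  set δ := ‖z 0 - w 0‖
  have he := Real.exp_pos (K * T)
  have he' : 0 ≤ Real.exp (K * T) / K := by positivity
  by_cases hK : (K : ℝ) = 0
  · rw [hK, gronwallBound_K0]
    simp only [div_zero, zero_mul, Real.exp_zero]
    nlinarith [mul_nonneg hδ hT, mul_nonneg hη hT]
  · rw [gronwallBound_of_K_ne_0 hK]
    have hK' : 0 < (K : ℝ) := lt_of_le_of_ne K.coe_nonneg (Ne.symm hK)
    have : η / K * (Real.exp (K * T) - 1) ≤ η * (Real.exp (K * T) / K) := by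
      rw [div_mul_eq_mul_div, mul_div_assoc]
      gcongr
      linarith
    nlinarith [mul_nonneg hδ hT, mul_nonneg hη hT, mul_nonneg hδ he.le, mul_nonneg hη he.le,
      mul_nonneg hδ he', mul_nonneg hη he']

theorem IsForwardOrbit.eq_of_eq {f : E → E} {K : NNReal} (hf : LipschitzWith K f) {z w : ℝ → E}
    (hz : IsForwardOrbit f z) (hw : IsForwardOrbit f w) (h0 : z 0 = w 0) {t : ℝ} (ht : 0 ≤ t) :
    z t = w t := by
  obtain ⟨C, -, hC⟩ := exists_dist_le_of_approx_orbit (E := E) K ht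
  have := hC hf (w' := fun t => f (w t)) le_rfl ⟨ht, le_rfl⟩ hz (fun s hs => hw s hs.1)
    (fun s _ => by simp)
  rw [h0, sub_self, norm_zero, add_zero, mul_zero] at this
  exact sub_eq_zero.1 (norm_le_zero_iff.1 this)

/-- On the ball of radius `‖f x₀‖` about `x₀` the field is bounded by `(K + 1) * ‖f x₀‖`, so
Picard–Lindelöf yields a time step that depends on `K` alone. The step can therefore be repeated
indefinitely. -/
theorem exists_solution_Icc_of_lipschitzWith [CompleteSpace E] {f : E → E} {K : NNReal}
    (hf : LipschitzWith K f) (x₀ : E) (a : ℝ) :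
    ∃ z : ℝ → E, z a = x₀ ∧ ∀ t ∈ Icc a (a + 1 / (2 * (K + 1))),
      HasDerivWithinAt z (f (z t)) (Icc a (a + 1 / (2 * (K + 1)))) t := by
  have hh : (0 : ℝ) ≤ 1 / (2 * (K + 1)) := by positivity
  have hP : IsPicardLindelof (fun _ => f) (tmin := a) (tmax := a + 1 / (2 * (K + 1)))
      ⟨a, le_rfl, by linarith⟩ x₀ ‖f x₀‖₊ 0 ((K + 1) * ‖f x₀‖₊) K := by
    refine IsPicardLindelof.of_time_independent (fun x hx => ?_) hf.lipschitzOnWith ?_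
    · have h1 := hf.dist_le_mul x x₀
      rw [Metric.mem_closedBall] at hx
      rw [dist_eq_norm (f x)] at h1
      have h2 : ‖f x‖ ≤ ‖f x - f x₀‖ + ‖f x₀‖ := by
        simpa using norm_add_le (f x - f x₀) (f x₀)
      have h3 : (K : ℝ) * dist x x₀ ≤ K * ‖f x₀‖ := by
        gcongr
        simpa using hx
      simp only [NNReal.coe_mul, NNReal.coe_add, NNReal.coe_one, coe_nnnorm]
      nlinarith
    · have : (0 : ℝ) ≤ ‖f x₀‖ := norm_nonneg _
      simp only [add_sub_cancel_left, sub_self, NNReal.coe_mul, NNReal.coe_add, NNReal.coe_one,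
        coe_nnnorm, NNReal.coe_zero, sub_zero]
      rw [max_eq_left hh]
      have : ((K : ℝ) + 1) * ‖f x₀‖ * (1 / (2 * (K + 1))) = ‖f x₀‖ / 2 := by
        field_simp
      linarith
  exact hP.exists_eq_forall_mem_Icc_hasDerivWithinAt₀

theorem exists_solution_Icc_nsmul_of_lipschitzWith [CompleteSpace E] {f : E → E} {K : NNReal}
    (hf : LipschitzWith K f) (x₀ : E) (n : ℕ) :
    ∃ z : ℝ → E, z 0 = x₀ ∧ ∀ t ∈ Icc 0 (n * (1 / (2 * ((K : ℝ) + 1)))),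
      HasDerivWithinAt z (f (z t)) (Icc 0 (n * (1 / (2 * ((K : ℝ) + 1))))) t := by
  induction n with
  | zero =>
    refine ⟨fun _ => x₀, rfl, fun t ht => ?_⟩
    simp only [Nat.cast_zero, zero_mul, Icc_self, mem_singleton_iff] at ht ⊢
    subst ht
    exact HasFDerivWithinAt.of_subsingleton subsingleton_singleton
  | succ n ih =>
    obtain ⟨z, hz0, hz⟩ := ih
    set h : ℝ := 1 / (2 * ((K : ℝ) + 1)) with hh
    have hpos : 0 < h := by positivity
    set a : ℝ := n * h with ha
    have ha0 : 0 ≤ a := by positivity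
    obtain ⟨w, hw0, hw⟩ := exists_solution_Icc_of_lipschitzWith hf (z a) a
    rw [← hh] at hw
    have hb : ((n + 1 : ℕ) : ℝ) * h = a + h := by push_cast; ring
    rw [hb]
    set u : ℝ → E := fun t => if t ≤ a then z t else w t with hu
    have huz : ∀ t ≤ a, u t = z t := fun t ht => by simp [hu, ht]
    have huw : ∀ t, a ≤ t → u t = w t := fun t ht => by
      rcases ht.eq_or_lt with rfl | ht
      · simp [hu, hw0]
      · simp [hu, not_le.2 ht]
    refine ⟨u, by rw [huz 0 ha0, hz0], fun t ht => ?_⟩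
    have key1 : HasDerivWithinAt u (f (u t)) (Icc 0 a) t := by
      by_cases hta : t ≤ a
      · rw [huz t hta]
        exact (hz t ⟨ht.1, hta⟩).congr (fun s hs => huz s hs.2) (huz t hta)
      · exact HasFDerivWithinAt.of_notMem_closure (by
          rw [closure_Icc]; exact fun hc => hta hc.2)
    have key2 : HasDerivWithinAt u (f (u t)) (Icc a (a + h)) t := by
      by_cases hta : a ≤ t
      · rw [huw t hta]
        exact (hw t ⟨hta, ht.2⟩).congr (fun s hs => huw s hs.1) (huw t hta)
      · exact HasFDerivWithinAt.of_notMem_closure (by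
          rw [closure_Icc]; exact fun hc => hta hc.1)
    have := key1.union key2
    rwa [Icc_union_Icc_eq_Icc ha0 (by linarith)] at this

/-- A Lipschitz field has a forward orbit from every point. -/
theorem LipschitzWith.exists_isForwardOrbit [CompleteSpace E] {f : E → E} {K : NNReal}
    (hf : LipschitzWith K f) (x₀ : E) : ∃ z : ℝ → E, IsForwardOrbit f z ∧ z 0 = x₀ := by
  choose z hz0 hz using exists_solution_Icc_nsmul_of_lipschitzWith hf x₀
  set h : ℝ := 1 / (2 * ((K : ℝ) + 1)) with hh
  have hpos : 0 < h := by positivity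
  have huniq : ∀ n m : ℕ, ∀ t : ℝ, 0 ≤ t → t ≤ n * h → t ≤ m * h → z n t = z m t := by
    intro n m t ht hn hm
    refine ODE_solution_unique_of_mem_Icc_right (v := fun _ => f) (s := fun _ => univ) (a := 0)
      (b := t) (fun _ _ => hf.lipschitzOnWith)
      (fun s hs => (hz n s ⟨hs.1, hs.2.trans hn⟩).continuousWithinAt.mono
        (Icc_subset_Icc_right hn)) (fun s hs => ?_) (fun _ _ => trivial)
      (fun s hs => (hz m s ⟨hs.1, hs.2.trans hm⟩).continuousWithinAt.mono
        (Icc_subset_Icc_right hm)) (fun s hs => ?_) (fun _ _ => trivial) (by rw [hz0, hz0])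
      ⟨ht, le_rfl⟩
    · exact (hz n s ⟨hs.1, hs.2.le.trans hn⟩).mono_of_mem_nhdsWithin
        (mem_of_superset (Icc_mem_nhdsGE (hs.2.trans_le hn)) (Icc_subset_Icc_left hs.1))
    · exact (hz m s ⟨hs.1, hs.2.le.trans hm⟩).mono_of_mem_nhdsWithin
        (mem_of_superset (Icc_mem_nhdsGE (hs.2.trans_le hm)) (Icc_subset_Icc_left hs.1))
  have hlt : ∀ t : ℝ, t < ((⌊t / h⌋₊ + 1 : ℕ) : ℝ) * h := fun t => by
    rw [← div_lt_iff₀ hpos]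
    exact_mod_cast Nat.lt_floor_add_one (t / h)
  -- The `+ 1` puts `t` strictly before the right end of the interval used, which is thus a
  -- neighbourhood of `t` in `[0, ∞)`.
  refine ⟨fun t => z (⌊t / h⌋₊ + 1) t, fun t ht => ?_, hz0 _⟩
  have h1 := hz (⌊t / h⌋₊ + 1) t ⟨ht, (hlt t).le⟩
  refine (h1.congr (f₁ := fun t => z (⌊t / h⌋₊ + 1) t) (fun s hs => ?_) rfl).mono_of_mem_nhdsWithin
    ?_
  · exact huniq _ _ s hs.1 (hlt s).le hs.2
  · rw [← Ici_inter_Iic]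
    exact inter_mem_nhdsWithin _ (Iic_mem_nhds (hlt t))

end ForwardOrbits

/-! ### Uniform contraction for homogeneous layer equations. -/

/-- A family of globally attracting equilibria `H y` of fields `f y` on `E`, positively homogeneous
of degree one in `(y, x)`, for which the flow of `f (±1)` near `H (±1)` is homogeneous. -/
structure IsHomogeneousLayer {E : Type*} [NormedAddCommGroup E] [NormedSpace ℝ E]
    (f : ℝ → E → E) (H : ℝ → E) : Prop where
  lipschitz : ∃ K, LipschitzWith K fun p : ℝ × E => f p.1 p.2
  field_smul : ∀ {c : ℝ}, 0 < c → ∀ y x, f (c * y) (c • x) = c • f y x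
  continuous : Continuous H
  smul : ∀ {c : ℝ}, 0 < c → ∀ y, H (c * y) = c • H y
  equilibrium : ∀ y, f y (H y) = 0
  attracting : ∀ {y x}, IsForwardOrbit (f y) x → Tendsto x atTop (𝓝 (H y))
  dilation : ∃ r : ℝ, 0 < r ∧ ∀ {y c : ℝ} {x : ℝ → E}, |y| = 1 → 1 ≤ c → IsForwardOrbit (f y) x →
    ‖c • (x 0 - H y)‖ ≤ r →
    IsForwardOrbit (f y) fun t => H y + c • (x t - H y)

namespace IsHomogeneousLayer

variable {E : Type*} [NormedAddCommGroup E] [NormedSpace ℝ E] {f : ℝ → E → E} {H : ℝ → E}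

theorem exists_lipschitzWith (hf : IsHomogeneousLayer f H) : ∃ K, ∀ y, LipschitzWith K (f y) := by
  obtain ⟨K, hK⟩ := hf.lipschitz
  refine ⟨K, fun y => LipschitzWith.of_dist_le_mul fun a b => ?_⟩
  simpa [Prod.dist_eq] using hK.dist_le_mul (y, a) (y, b)

theorem isForwardOrbit_const (hf : IsHomogeneousLayer f H) (y : ℝ) :
    IsForwardOrbit (f y) fun _ => H y := fun t _ => by
  simp only [hf.equilibrium]
  exact hasDerivWithinAt_const _ _ _

theorem exists_norm_sub_le (hf : IsHomogeneousLayer f H) {T : ℝ} (hT : 0 ≤ T) :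
    ∃ C : ℝ, 1 ≤ C ∧ ∀ {y : ℝ} {x : ℝ → E} {t : ℝ}, IsForwardOrbit (f y) x → t ∈ Icc 0 T →
      ‖x t - H y‖ ≤ C * ‖x 0 - H y‖ := by
  obtain ⟨K, hK⟩ := hf.exists_lipschitzWith
  obtain ⟨C, hC1, hC⟩ := exists_dist_le_of_approx_orbit (E := E) K hT
  refine ⟨C, hC1, fun {y x t} hx ht => ?_⟩
  simpa using hC (hK y) (w := fun _ => H y) (w' := fun _ => 0) le_rfl ht hx
    (fun s hs => hasDerivWithinAt_const _ _ _) (fun s hs => by simp [hf.equilibrium])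

theorem exists_norm_sub_le_of_orbits (hf : IsHomogeneousLayer f H) {T : ℝ} (hT : 0 ≤ T) :
    ∃ C : ℝ, ∀ {y y' : ℝ} {x x' : ℝ → E}, IsForwardOrbit (f y) x → IsForwardOrbit (f y') x' →
      ‖x T - x' T‖ ≤ C * ‖(y, x 0) - (y', x' 0)‖ := by
  obtain ⟨K, hK⟩ := hf.lipschitz
  obtain ⟨C, hC1, hC⟩ := exists_dist_le_of_approx_orbit (E := ℝ × E) K hT
  -- The parameter `y` becomes a state with zero velocity, so that Grönwall gives joint dependence
  -- on `y` and `x 0`.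
  have hL : LipschitzWith K fun p : ℝ × E => ((0 : ℝ), f p.1 p.2) := by
    refine LipschitzWith.of_dist_le_mul fun a b => ?_
    rw [Prod.dist_eq]
    simpa using hK.dist_le_mul a b
  have hext : ∀ {y : ℝ} {x : ℝ → E}, IsForwardOrbit (f y) x →
      IsForwardOrbit (fun p : ℝ × E => ((0 : ℝ), f p.1 p.2)) fun t => (y, x t) :=
    fun hx t ht => (hasDerivWithinAt_const t _ _).prodMk (hx t ht)
  refine ⟨C, fun {y y' x x'} hx hx' => ?_⟩
  have := hC hL (w' := fun t => (0, f y' (x' t))) le_rfl ⟨hT, le_rfl⟩ (hext hx)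
    (fun s hs => hext hx' s hs.1) (fun s _ => by simp)
  rw [add_zero] at this
  exact (norm_snd_le ((y, x T) - (y', x' T))).trans this

theorem smul_orbit (hf : IsHomogeneousLayer f H) {c y : ℝ} (hc : 0 < c) {x : ℝ → E}
    (hx : IsForwardOrbit (f y) x) : IsForwardOrbit (f (c * y)) fun t => c • x t := fun t ht => by
  have h : HasDerivWithinAt (fun t => c • x t) (c • f y (x t)) (Ici 0) t := (hx t ht).const_smul c
  rwa [← hf.field_smul hc] at h

/-- Each single orbit contracts by attraction, and continuity of the flow at one fixed time passes
this to nearby data. Away from the equilibria the inequality is open, so finitely many times suffice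
on a compact set. -/
theorem exists_contraction_of_isCompact [CompleteSpace E] (hf : IsHomogeneousLayer f H)
    {Q : Set (ℝ × E)} (hQ : IsCompact Q) (hne : ∀ p ∈ Q, p.2 ≠ H p.1) :
    ∃ T : ℝ, 1 ≤ T ∧ ∀ {y : ℝ} {x : ℝ → E}, IsForwardOrbit (f y) x → (y, x 0) ∈ Q →
      ∃ τ ∈ Icc 1 T, ‖x τ - H y‖ ≤ 1 / 2 * ‖x 0 - H y‖ := by
  refine hQ.induction_on (p := fun Q => ∃ T : ℝ, 1 ≤ T ∧ ∀ {y : ℝ} {x : ℝ → E},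
    IsForwardOrbit (f y) x → (y, x 0) ∈ Q → ∃ τ ∈ Icc 1 T, ‖x τ - H y‖ ≤ 1 / 2 * ‖x 0 - H y‖)
    ⟨1, le_rfl, fun _ h => h.elim⟩ ?_ ?_ ?_
  · rintro s t hst ⟨T, hT, h⟩
    exact ⟨T, hT, fun hx hm => h hx (hst hm)⟩
  · rintro s t ⟨T, hT, h⟩ ⟨T', hT', h'⟩
    refine ⟨max T T', hT.trans (le_max_left _ _), fun hx hm => ?_⟩
    rcases hm with hm | hm
    · obtain ⟨τ, hτ, hle⟩ := h hx hm
      exact ⟨τ, ⟨hτ.1, hτ.2.trans (le_max_left _ _)⟩, hle⟩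
    · obtain ⟨τ, hτ, hle⟩ := h' hx hm
      exact ⟨τ, ⟨hτ.1, hτ.2.trans (le_max_right _ _)⟩, hle⟩
  · rintro ⟨y₀, ξ₀⟩ hp
    obtain ⟨K, hK⟩ := hf.exists_lipschitzWith
    obtain ⟨x₀, hx₀, rfl⟩ := (hK y₀).exists_isForwardOrbit ξ₀
    have hd : 0 < ‖x₀ 0 - H y₀‖ := norm_pos_iff.2 (sub_ne_zero.2 (hne _ hp))
    have hlim : Tendsto (fun t => ‖x₀ t - H y₀‖) atTop (𝓝 0) :=
      tendsto_iff_norm_sub_tendsto_zero.1 (hf.attracting hx₀)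
    -- Asking for a quarter where a half is needed leaves room for perturbing `(y, x 0)`.
    obtain ⟨τ, hτ, hτ1⟩ := ((hlim.eventually (gt_mem_nhds (show 0 < ‖x₀ 0 - H y₀‖ / 4 by
      positivity))).and (eventually_ge_atTop 1)).exists
    obtain ⟨C, hC⟩ := hf.exists_norm_sub_le_of_orbits (zero_le_one.trans hτ1)
    have hcont : Continuous fun p : ℝ × E => 1 / 2 * ‖p.2 - H p.1‖ -
        (C * ‖p - (y₀, x₀ 0)‖ + ‖H p.1 - H y₀‖ + ‖x₀ 0 - H y₀‖ / 4) := by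
      have := hf.continuous
      fun_prop
    have hpos := (hcont.tendsto (y₀, x₀ 0)).eventually (lt_mem_nhds (a := 0)
      (by simp only [sub_self, norm_zero]; linarith))
    refine ⟨_, mem_nhdsWithin_of_mem_nhds hpos, τ, hτ1, fun {y x} hx hm => ⟨τ, ⟨hτ1, le_rfl⟩, ?_⟩⟩
    have hm' : 0 < 1 / 2 * ‖x 0 - H y‖ - (C * ‖(y, x 0) - (y₀, x₀ 0)‖ + ‖H y - H y₀‖ +
      ‖x₀ 0 - H y₀‖ / 4) := hm
    have h1 := hC hx hx₀
    have h2 : ‖x τ - H y‖ ≤ ‖x τ - x₀ τ‖ + ‖x₀ τ - H y₀‖ + ‖H y - H y₀‖ := by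
      have : x τ - H y = (x τ - x₀ τ) + (x₀ τ - H y₀) - (H y - H y₀) := by abel
      rw [this]
      exact (norm_sub_le _ _).trans (by gcongr; exact norm_add_le _ _)
    linarith

/-- Every layer orbit halves its distance to the equilibrium within a uniform time. -/
theorem exists_contraction_time [FiniteDimensional ℝ E] (hf : IsHomogeneousLayer f H) :
    ∃ T : ℝ, 1 ≤ T ∧ ∀ {y : ℝ} {x : ℝ → E}, IsForwardOrbit (f y) x →
      ∃ τ ∈ Icc 1 T, ‖x τ - H y‖ ≤ 1 / 2 * ‖x 0 - H y‖ := by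
  have := FiniteDimensional.proper ℝ E
  obtain ⟨K, hK⟩ := hf.exists_lipschitzWith
  obtain ⟨r, hr, hdil⟩ := hf.dilation
  -- Normalised data, written as pairs `(y, x - H y)`: either the deviation has norm one and `y` is
  -- bounded, or `|y| = 1` and the deviation has norm `r`.
  set Q₀ : Set (ℝ × E) := (Metric.closedBall 0 (1 / r) ×ˢ Metric.sphere 0 1) ∪
    (Metric.sphere 0 1 ×ˢ Metric.sphere 0 r) with hQ₀
  have hQ₀c : IsCompact Q₀ := ((isCompact_closedBall _ _).prod (isCompact_sphere _ _)).union
    ((isCompact_sphere _ _).prod (isCompact_sphere _ _))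
  have hshift : Continuous fun p : ℝ × E => (p.1, H p.1 + p.2) := by
    have := hf.continuous
    fun_prop
  obtain ⟨T, hT, hcontr⟩ := hf.exists_contraction_of_isCompact (hQ₀c.image hshift) (by
    rintro _ ⟨p, hp, rfl⟩ heq
    have h0 : p.2 = 0 := by simpa using heq
    rcases hp with ⟨-, hp⟩ | ⟨-, hp⟩ <;> rw [h0] at hp <;> simp at hp
    exact hr.ne hp)
  have hmem : ∀ {y : ℝ} {ξ : E}, (y, ξ - H y) ∈ Q₀ → (y, ξ) ∈ (fun p : ℝ × E => (p.1, H p.1 + p.2)) ''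
      Q₀ := fun {y ξ} h => ⟨_, h, by simp⟩
  refine ⟨T, hT, fun {y x} hx => ?_⟩
  rcases (norm_nonneg (x 0 - H y)).eq_or_lt with hd | hd
  · refine ⟨1, ⟨le_rfl, hT⟩, ?_⟩
    rw [hx.eq_of_eq (hK y) (hf.isForwardOrbit_const y) (sub_eq_zero.1 (norm_eq_zero.1 hd.symm))
      zero_le_one]
    simp
  set d := ‖x 0 - H y‖ with hd'
  -- If `|y|` is at most `d / r`, scaling by `d⁻¹` reaches the first piece of `Q₀`. Otherwise
  -- scaling by `|y|⁻¹` makes the deviation smaller than `r`, and dilating by `r * |y| / d ≥ 1`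
  -- about the equilibrium reaches the second.
  rcases le_or_gt |y| (d / r) with hy | hy
  · have hc : 0 < d⁻¹ := inv_pos.2 hd
    have hsub : ∀ t, d⁻¹ • x t - H (d⁻¹ * y) = d⁻¹ • (x t - H y) := fun t => by
      rw [hf.smul hc, smul_sub]
    obtain ⟨τ, hτ, hle⟩ := hcontr (hf.smul_orbit hc hx) (hmem (Or.inl ⟨by
        rw [mem_closedBall_zero_iff, norm_mul, Real.norm_eq_abs, Real.norm_eq_abs, abs_of_pos hc]
        calc d⁻¹ * |y| ≤ d⁻¹ * (d / r) := by gcongr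
          _ = 1 / r := by field_simp, by
        rw [mem_sphere_zero_iff_norm, hsub, norm_smul, Real.norm_eq_abs, abs_of_pos hc, ← hd']
        exact inv_mul_cancel₀ hd.ne'⟩))
    refine ⟨τ, hτ, ?_⟩
    rw [hsub, hsub, norm_smul, norm_smul, Real.norm_eq_abs, abs_of_pos hc, mul_left_comm] at hle
    exact le_of_mul_le_mul_left hle hc
  · have hypos : 0 < |y| := lt_of_le_of_lt (by positivity) hy
    have hc : 0 < |y|⁻¹ := inv_pos.2 hypos
    have hb : 0 < r * |y| / d := by positivity
    have hsub : ∀ t, |y|⁻¹ • x t - H (|y|⁻¹ * y) = |y|⁻¹ • (x t - H y) := fun t => by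
      rw [hf.smul hc, smul_sub]
    have hone : |(|y|⁻¹ * y)| = 1 := by
      rw [abs_mul, abs_of_pos hc]
      exact inv_mul_cancel₀ hypos.ne'
    have hnorm : ‖(r * |y| / d) • (|y|⁻¹ • (x 0 - H y))‖ = r := by
      rw [norm_smul, norm_smul, Real.norm_eq_abs, Real.norm_eq_abs, abs_of_pos hc, abs_of_pos hb,
        ← hd']
      field_simp
    rw [div_lt_iff₀ hr] at hy
    have hc1 : 1 ≤ r * |y| / d := (one_le_div hd).2 (by rw [mul_comm]; exact hy.le)
    have hx' := hdil hone hc1 (hf.smul_orbit hc hx)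
      (by rw [hsub, hnorm])
    obtain ⟨τ, hτ, hle⟩ := hcontr hx' (hmem (Or.inr ⟨by
      rw [mem_sphere_zero_iff_norm, Real.norm_eq_abs, hone], by
      rw [mem_sphere_zero_iff_norm, add_sub_cancel_left, hsub, hnorm]⟩))
    refine ⟨τ, hτ, ?_⟩
    simp only [add_sub_cancel_left, hsub, norm_smul, Real.norm_eq_abs, abs_of_pos hc, abs_of_pos hb,
      mul_left_comm (1 / 2 : ℝ)] at hle
    exact le_of_mul_le_mul_left (le_of_mul_le_mul_left hle hb) hc

/-- The halving time `τ` depends on the orbit but lies in `[1, S]`. Restarting at each such time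
bounds the overshoot once and for all and gives geometric decay; waiting long enough absorbs the
overshoot constant. -/
theorem exists_uniform_contraction [FiniteDimensional ℝ E] (hf : IsHomogeneousLayer f H) :
    ∃ T C : ℝ, 0 < T ∧ 1 ≤ C ∧ ∀ {y : ℝ} {x : ℝ → E}, IsForwardOrbit (f y) x →
      (∀ t ∈ Icc 0 T, ‖x t - H y‖ ≤ C * ‖x 0 - H y‖) ∧ ‖x T - H y‖ ≤ 1 / 2 * ‖x 0 - H y‖ := by
  obtain ⟨S, hS, hcontr⟩ := hf.exists_contraction_time
  have hS0 : 0 ≤ S := zero_le_one.trans hS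
  obtain ⟨C, hC1, hC⟩ := hf.exists_norm_sub_le hS0
  have hC0 : 0 ≤ C := zero_le_one.trans hC1
  -- The constant does not grow with `n`: a restart begins at a distance no larger than the original
  -- one. Since `τ ≥ 1`, each restart gains one unit of time.
  have hbound : ∀ n : ℕ, ∀ {y : ℝ} {x : ℝ → E} {t : ℝ}, IsForwardOrbit (f y) x →
      t ∈ Icc 0 (S + n) → ‖x t - H y‖ ≤ C * ‖x 0 - H y‖ := by
    intro n
    induction n with
    | zero => exact fun hx ht => hC hx (by simpa using ht)
    | succ n ih =>
      intro y x t hx ht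
      rcases le_or_gt t S with h | h
      · exact hC hx ⟨ht.1, h⟩
      · obtain ⟨τ, hτ, hle⟩ := hcontr hx
        have := ih (hx.shift (zero_le_one.trans hτ.1)) (t := t - τ)
          ⟨by linarith [hτ.2], by have := ht.2; push_cast at this; linarith [hτ.1]⟩
        simp only [add_sub_cancel, add_zero] at this
        refine this.trans ?_
        gcongr
        linarith [norm_nonneg (x 0 - H y)]
  have hdecay : ∀ n : ℕ, ∀ {y : ℝ} {x : ℝ → E} {t : ℝ}, IsForwardOrbit (f y) x →
      n * S ≤ t → ‖x t - H y‖ ≤ C * ((1 / 2) ^ n * ‖x 0 - H y‖) := by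
    intro n
    induction n with
    | zero =>
      intro y x t hx ht
      obtain ⟨n, hn⟩ := exists_nat_ge t
      simpa using hbound n hx ⟨by simpa using ht, by linarith⟩
    | succ n ih =>
      intro y x t hx ht
      push_cast at ht
      obtain ⟨τ, hτ, hle⟩ := hcontr hx
      have := ih (hx.shift (zero_le_one.trans hτ.1)) (t := t - τ) (by linarith [hτ.2])
      simp only [add_sub_cancel, add_zero] at this
      refine this.trans ?_
      rw [pow_succ, mul_assoc]
      gcongr
  obtain ⟨n, hn⟩ := exists_pow_lt_of_lt_one (show 0 < 1 / (2 * C) by positivity)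
    (show (1 / 2 : ℝ) < 1 by norm_num)
  refine ⟨n * S + 1, C, by positivity, hC1, fun {y x} hx => ⟨fun t ht => ?_, ?_⟩⟩
  · obtain ⟨m, hm⟩ := exists_nat_ge t
    exact hbound m hx ⟨ht.1, by linarith⟩
  · refine (hdecay n hx (by linarith)).trans ?_
    rw [← mul_assoc]
    gcongr
    calc C * (1 / 2) ^ n ≤ C * (1 / (2 * C)) := by gcongr
      _ = 1 / 2 := by field_simp

end IsHomogeneousLayer

/-! ### Functions that are linear on either side of the origin -/

/-- The function `ℝ → V` with slope `u` on `(-∞, 0]` and `v` on `[0, ∞)`. -/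
def bentLine {V : Type*} [AddCommGroup V] [Module ℝ V] (u v : V) (s : ℝ) : V :=
  min s 0 • u + max s 0 • v

section BentLine

variable {V : Type*} [NormedAddCommGroup V] [NormedSpace ℝ V]

theorem bentLine_of_nonpos (u v : V) {s : ℝ} (hs : s ≤ 0) : bentLine u v s = s • u := by
  simp [bentLine, hs]

theorem bentLine_of_nonneg (u v : V) {s : ℝ} (hs : 0 ≤ s) : bentLine u v s = s • v := by
  simp [bentLine, hs]

theorem bentLine_eq_ite (u v : V) (s : ℝ) : bentLine u v s = if s ≤ 0 then s • u else s • v := by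
  split_ifs with h
  · exact bentLine_of_nonpos u v h
  · exact bentLine_of_nonneg u v (not_le.1 h).le

theorem bentLine_mul (u v : V) {c : ℝ} (hc : 0 < c) (s : ℝ) :
    bentLine u v (c * s) = c • bentLine u v s := by
  rcases le_total s 0 with h | h
  · rw [bentLine_of_nonpos u v h, bentLine_of_nonpos u v (mul_nonpos_of_nonneg_of_nonpos hc.le h),
      mul_smul]
  · rw [bentLine_of_nonneg u v h, bentLine_of_nonneg u v (mul_nonneg hc.le h), mul_smul]

theorem norm_bentLine_sub_le (u v : V) (s t : ℝ) :
    ‖bentLine u v s - bentLine u v t‖ ≤ (‖u‖ + ‖v‖) * |s - t| := by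
  have h : bentLine u v s - bentLine u v t = (min s 0 - min t 0) • u + (max s 0 - max t 0) • v := by
    simp only [bentLine, sub_smul]; abel
  have h1 : |min s 0 - min t 0| ≤ |s - t| := by
    simpa using abs_min_sub_min_le_max s 0 t 0
  have h2 : |max s 0 - max t 0| ≤ |s - t| := by
    simpa using abs_max_sub_max_le_max s 0 t 0
  calc _ ≤ |min s 0 - min t 0| * ‖u‖ + |max s 0 - max t 0| * ‖v‖ := by
        rw [h, ← Real.norm_eq_abs, ← Real.norm_eq_abs, ← norm_smul, ← norm_smul]
        exact norm_add_le _ _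
    _ ≤ |s - t| * ‖u‖ + |s - t| * ‖v‖ := by gcongr
    _ = _ := by ring

theorem norm_bentLine_sub_bentLine_le (u v u' v' : V) (s : ℝ) :
    ‖bentLine u v s - bentLine u' v' s‖ ≤ |s| * (‖u - u'‖ + ‖v - v'‖) := by
  have h1 := norm_nonneg (u - u')
  have h2 := norm_nonneg (v - v')
  have h3 := abs_nonneg s
  rcases le_total s 0 with h | h
  · rw [bentLine_of_nonpos u v h, bentLine_of_nonpos u' v' h, ← smul_sub, norm_smul,
      Real.norm_eq_abs]
    nlinarith
  · rw [bentLine_of_nonneg u v h, bentLine_of_nonneg u' v' h, ← smul_sub, norm_smul,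
      Real.norm_eq_abs]
    nlinarith

theorem continuous_bentLine (u v : V) : Continuous (bentLine u v) := by
  unfold bentLine
  fun_prop

end BentLine

/-! ### Companion matrices -/

section Companion

variable {k : ℕ}

theorem toEuclideanCLM_companionMatrix [NeZero k] (p x : EuclideanSpace ℝ (Fin k)) :
    Matrix.toEuclideanCLM (𝕜 := ℝ) (companionMatrix p) x =
      Matrix.toEuclideanCLM (𝕜 := ℝ) (shiftMatrix k) x - x 0 • p := by
  ext i
  simp [companionMatrix, eFirst, Matrix.ofLp_toEuclideanCLM, Matrix.vecMulVec_mulVec,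
    mul_comm]

/-- The Horner scheme of the characteristic polynomial of the companion matrix `J_k - p e_1ᵀ`. -/
def companionHorner (p : EuclideanSpace ℝ (Fin k)) (l : ℝ) : ℕ → ℝ
  | 0 => 1
  | n + 1 => l * companionHorner p l n + if h : n < k then p ⟨n, h⟩ else 0

theorem companionHorner_succ (p : EuclideanSpace ℝ (Fin k)) (l : ℝ) (i : Fin k) :
    companionHorner p l (i.val + 1) = l * companionHorner p l i.val + p i := by
  simp [companionHorner]

theorem continuous_companionHorner (p : EuclideanSpace ℝ (Fin k)) (n : ℕ) :
    Continuous fun l => companionHorner p l n := by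
  induction n with
  | zero => exact continuous_const
  | succ n ih => exact (continuous_id.mul ih).add continuous_const

theorem one_le_companionHorner (p : EuclideanSpace ℝ (Fin k)) (n : ℕ) :
    1 ≤ companionHorner p (1 + ‖p‖) n := by
  induction n with
  | zero => exact le_rfl
  | succ n ih =>
    have h : -‖p‖ ≤ if h : n < k then p ⟨n, h⟩ else 0 := by
      split_ifs with h
      · have := PiLp.norm_apply_le p ⟨n, h⟩
        rw [Real.norm_eq_abs] at this
        linarith [neg_abs_le (p ⟨n, h⟩)]
      · simp
    have := norm_nonneg p
    simp only [companionHorner]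
    nlinarith

theorem companionMatrix_mulVec_companionHorner [NeZero k] (p : EuclideanSpace ℝ (Fin k)) {l : ℝ}
    (hl : companionHorner p l k = 0) :
    (companionMatrix p).mulVec (fun i => companionHorner p l i.val) =
      l • fun i : Fin k => companionHorner p l i.val := by
  have h := toEuclideanCLM_companionMatrix p
    (WithLp.toLp 2 fun i : Fin k => companionHorner p l i.val)
  rw [Matrix.toEuclideanCLM_toLp, Matrix.toEuclideanCLM_toLp] at h
  ext i
  have hi := congrFun (congrArg WithLp.ofLp h) i
  simp only [PiLp.sub_apply, PiLp.smul_apply, Fin.val_zero] at hi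
  rw [hi]
  have hs := companionHorner_succ p l i
  have hshift : (shiftMatrix k).mulVec (fun i => companionHorner p l i.val) i =
      companionHorner p l (i.val + 1) := by
    simp only [Matrix.mulVec, dotProduct, shiftMatrix, Matrix.of_apply, ite_mul, one_mul, zero_mul]
    by_cases hik : i.val + 1 < k
    · rw [Finset.sum_eq_single ⟨i.val + 1, hik⟩]
      · simp
      · intro j _ hj
        rw [if_neg]
        exact fun hc => hj (Fin.ext hc.symm)
      · simp
    · have : i.val + 1 = k := by omega
      rw [this, hl]
      refine Finset.sum_eq_zero fun j _ => if_neg ?_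
      omega
  rw [hshift, hs]
  simp [companionHorner]

/-- The last coefficient is the characteristic polynomial at `0`. Were it nonpositive, the
intermediate value theorem would give a nonnegative real root, hence an eigenvalue that a Hurwitz
matrix cannot have. -/
theorem IsHurwitz.companion_last_pos [NeZero k] {p : EuclideanSpace ℝ (Fin k)}
    (hp : IsHurwitz (companionMatrix p)) : 0 < p (lastIdx k) := by
  by_contra! hle
  have h0 : companionHorner p 0 k ≤ 0 := by
    have := companionHorner_succ p 0 (lastIdx k)
    have hk : (lastIdx k).val + 1 = k := Nat.succ_pred_eq_of_pos (NeZero.pos k)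
    rw [hk] at this
    rw [this]
    simpa using hle
  obtain ⟨l, hl, hroot⟩ := intermediate_value_Icc (by positivity : (0 : ℝ) ≤ 1 + ‖p‖)
    (continuous_companionHorner p k).continuousOn
    ⟨h0, zero_le_one.trans (one_le_companionHorner p k)⟩
  refine absurd (hp l fun hu => ?_) (by simpa using hl.1)
  have hev := companionMatrix_mulVec_companionHorner p hroot
  set u : Fin k → ℝ := fun i => companionHorner p l i.val
  have hC : ((companionMatrix p).map (fun r : ℝ => (r : ℂ))).mulVec (fun i => (u i : ℂ)) =
      fun i => (l : ℂ) * u i := by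
    ext i
    have h1 := RingHom.map_mulVec Complex.ofRealHom (companionMatrix p) u i
    rw [hev] at h1
    exact h1.symm.trans (by simp)
  have hker : ((algebraMap ℂ (Matrix (Fin k) (Fin k) ℂ)) l -
      (companionMatrix p).map (fun r : ℝ => (r : ℂ))).mulVec (fun i => (u i : ℂ)) = 0 := by
    rw [Matrix.sub_mulVec, hC, Matrix.algebraMap_eq_diagonal]
    ext i
    simp [Matrix.mulVec_diagonal]
  have := Matrix.mulVec_injective_of_isUnit hu (hker.trans (Matrix.mulVec_zero _).symm)
  -- The eigenvector is nonzero: its first entry is `1`.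
  have h1 := congrFun this 0
  simp [u, companionHorner] at h1

end Companion

/-! ### The fields of the slow-fast system: Lipschitz bounds, homogeneity and dilation of the layer
equations. -/

namespace SFOCF

variable {k m : ℕ} [NeZero k]

/-- The two sides differ only in the rank-one term, so the switching is carried by `bentLine`,
whence continuity, Lipschitz bounds and homogeneity. -/
theorem fastField_eq (S : SFOCF k m) (ε y₁ : ℝ) (x : EuclideanSpace ℝ (Fin k)) :
    S.fastField ε y₁ x = Matrix.toEuclideanCLM (𝕜 := ℝ) (shiftMatrix k) x -
      bentLine (S.aL ε) (S.aR ε) (x 0) + y₁ • eLast k := by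
  rw [fastField, bentLine_eq_ite]
  split_ifs <;> rw [toEuclideanCLM_companionMatrix]

theorem slowField_eq [NeZero m] (S : SFOCF k m) (ε : ℝ)
    (z : EuclideanSpace ℝ (Fin k) × EuclideanSpace ℝ (Fin m)) :
    S.slowField ε z = -bentLine (S.bL ε) (S.bR ε) (z.1 0) +
      Matrix.toEuclideanCLM (𝕜 := ℝ) (shiftMatrix m) z.2 + S.μ • eLast m := by
  rw [slowField, bentLine_eq_ite]
  split_ifs <;> rfl

theorem branch_eq_smul (a : EuclideanSpace ℝ (Fin k)) (y₁ : ℝ) :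
    branch a y₁ = y₁ • branch a 1 := by
  ext i
  simp only [branch, PiLp.smul_apply, smul_eq_mul]
  ring

theorem branch_apply_zero (a : EuclideanSpace ℝ (Fin k)) (y₁ : ℝ) :
    branch a y₁ 0 = y₁ / a (lastIdx k) := by
  simp [branch]

theorem H_eq (S : SFOCF k m) (y₁ : ℝ) :
    S.H y₁ = bentLine (branch (S.aL 0) 1) (branch (S.aR 0) 1) y₁ := by
  rw [H, bentLine_eq_ite, ← branch_eq_smul, ← branch_eq_smul]

theorem H_apply_zero (S : SFOCF k m) (y₁ : ℝ) :
    S.H y₁ 0 = if y₁ ≤ 0 then y₁ / S.aL 0 (lastIdx k) else y₁ / S.aR 0 (lastIdx k) := by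
  rw [H]
  split_ifs <;> rw [branch_apply_zero]

theorem continuous_H (S : SFOCF k m) : Continuous S.H := by
  simpa only [funext S.H_eq] using continuous_bentLine _ _

/-- Since `a_k > 0`, the first coordinate of `H(y₁)` has the sign of `y₁`. The reduced field is thus
the slow field for `ε = 0` on the critical manifold. -/
theorem reducedField_eq [NeZero m] (S : SFOCF k m) (hS : S.IsGloballyStable)
    (y : EuclideanSpace ℝ (Fin m)) :
    S.reducedField y = -bentLine (S.bL 0) (S.bR 0) (S.H (y 0) 0) +
      Matrix.toEuclideanCLM (𝕜 := ℝ) (shiftMatrix m) y + S.μ • eLast m := by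
  have hL := hS.hurwitzL.companion_last_pos
  have hR := hS.hurwitzR.companion_last_pos
  rw [reducedField, H_apply_zero]
  split_ifs with h
  · rw [bentLine_of_nonpos _ _ (div_nonpos_of_nonpos_of_nonneg h hL.le),
      toEuclideanCLM_companionMatrix, smul_smul, div_eq_mul_inv]
    abel
  · rw [bentLine_of_nonneg _ _ (div_nonneg (not_le.1 h).le hR.le),
      toEuclideanCLM_companionMatrix, smul_smul, div_eq_mul_inv]
    abel

theorem exists_lipschitzWith_fastField (S : SFOCF k m) (ε : ℝ) :
    ∃ K, LipschitzWith K fun p : ℝ × EuclideanSpace ℝ (Fin k) => S.fastField ε p.1 p.2 := by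
  refine ⟨Real.toNNReal (‖Matrix.toEuclideanCLM (𝕜 := ℝ) (shiftMatrix k)‖ +
    (‖S.aL ε‖ + ‖S.aR ε‖) + ‖eLast k‖), LipschitzWith.of_dist_le_mul fun p q => ?_⟩
  rw [Real.coe_toNNReal _ (by positivity), dist_eq_norm, dist_eq_norm, fastField_eq, fastField_eq]
  have h1 := (Matrix.toEuclideanCLM (𝕜 := ℝ) (shiftMatrix k)).le_opNorm (p.2 - q.2)
  have h2 := norm_bentLine_sub_le (S.aL ε) (S.aR ε) (p.2 0) (q.2 0)
  have h3 : |p.2 0 - q.2 0| ≤ ‖p.2 - q.2‖ := PiLp.norm_apply_le (p.2 - q.2) 0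
  have h4 : ‖p.2 - q.2‖ ≤ ‖p - q‖ := norm_snd_le (p - q)
  have h5 : ‖p.1 - q.1‖ ≤ ‖p - q‖ := norm_fst_le (p - q)
  have : Matrix.toEuclideanCLM (𝕜 := ℝ) (shiftMatrix k) p.2 -
      bentLine (S.aL ε) (S.aR ε) (p.2 0) + p.1 • eLast k -
      (Matrix.toEuclideanCLM (𝕜 := ℝ) (shiftMatrix k) q.2 -
      bentLine (S.aL ε) (S.aR ε) (q.2 0) + q.1 • eLast k) =
      Matrix.toEuclideanCLM (𝕜 := ℝ) (shiftMatrix k) (p.2 - q.2) -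
      (bentLine (S.aL ε) (S.aR ε) (p.2 0) - bentLine (S.aL ε) (S.aR ε) (q.2 0)) +
      (p.1 - q.1) • eLast k := by
    rw [map_sub, sub_smul]; abel
  rw [this]
  have h6 := norm_add_le (Matrix.toEuclideanCLM (𝕜 := ℝ) (shiftMatrix k) (p.2 - q.2) -
    (bentLine (S.aL ε) (S.aR ε) (p.2 0) - bentLine (S.aL ε) (S.aR ε) (q.2 0)))
    ((p.1 - q.1) • eLast k)
  have h7 := norm_sub_le (Matrix.toEuclideanCLM (𝕜 := ℝ) (shiftMatrix k) (p.2 - q.2))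
    (bentLine (S.aL ε) (S.aR ε) (p.2 0) - bentLine (S.aL ε) (S.aR ε) (q.2 0))
  have h8 := mul_le_mul_of_nonneg_left h4
    (norm_nonneg (Matrix.toEuclideanCLM (𝕜 := ℝ) (shiftMatrix k)))
  have h9 := mul_le_mul_of_nonneg_left (h3.trans h4)
    (add_nonneg (norm_nonneg (S.aL ε)) (norm_nonneg (S.aR ε)))
  have h10 := mul_le_mul_of_nonneg_right h5 (norm_nonneg (eLast k))
  rw [norm_smul] at h6
  linarith

/-- The separate real argument allows both uses: it is `x₁` for the slow field and the first
coordinate of `H(y₁)` for the reduced one. -/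
theorem exists_lipschitzWith_bentLine_shift (m : ℕ) [NeZero m] (u v w : EuclideanSpace ℝ (Fin m)) :
    ∃ K, LipschitzWith K fun p : ℝ × EuclideanSpace ℝ (Fin m) =>
      -bentLine u v p.1 + Matrix.toEuclideanCLM (𝕜 := ℝ) (shiftMatrix m) p.2 + w := by
  refine ⟨Real.toNNReal ((‖u‖ + ‖v‖) + ‖Matrix.toEuclideanCLM (𝕜 := ℝ) (shiftMatrix m)‖),
    LipschitzWith.of_dist_le_mul fun p q => ?_⟩
  rw [Real.coe_toNNReal _ (by positivity), dist_eq_norm, dist_eq_norm]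
  have h1 := (Matrix.toEuclideanCLM (𝕜 := ℝ) (shiftMatrix m)).le_opNorm (p.2 - q.2)
  have h2 := norm_bentLine_sub_le u v p.1 q.1
  have h4 : ‖p.2 - q.2‖ ≤ ‖p - q‖ := norm_snd_le (p - q)
  have h5 : |p.1 - q.1| ≤ ‖p - q‖ := norm_fst_le (p - q)
  have : -bentLine u v p.1 + Matrix.toEuclideanCLM (𝕜 := ℝ) (shiftMatrix m) p.2 + w -
      (-bentLine u v q.1 + Matrix.toEuclideanCLM (𝕜 := ℝ) (shiftMatrix m) q.2 + w) =
      Matrix.toEuclideanCLM (𝕜 := ℝ) (shiftMatrix m) (p.2 - q.2) -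
      (bentLine u v p.1 - bentLine u v q.1) := by
    rw [map_sub]; abel
  rw [this]
  have h7 := norm_sub_le (Matrix.toEuclideanCLM (𝕜 := ℝ) (shiftMatrix m) (p.2 - q.2))
    (bentLine u v p.1 - bentLine u v q.1)
  have h8 := mul_le_mul_of_nonneg_left h4
    (norm_nonneg (Matrix.toEuclideanCLM (𝕜 := ℝ) (shiftMatrix m)))
  have h9 := mul_le_mul_of_nonneg_left h5 (add_nonneg (norm_nonneg u) (norm_nonneg v))
  linarith

theorem lipschitzWith_apply_zero (n : ℕ) [NeZero n] :
    LipschitzWith 1 fun x : EuclideanSpace ℝ (Fin n) => x 0 :=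
  LipschitzWith.of_dist_le_mul fun x y => by
    simpa [dist_eq_norm] using PiLp.norm_apply_le (x - y) 0

theorem exists_lipschitzWith_H (S : SFOCF k m) : ∃ K, LipschitzWith K S.H := by
  refine ⟨Real.toNNReal (‖branch (S.aL 0) 1‖ + ‖branch (S.aR 0) 1‖),
    LipschitzWith.of_dist_le_mul fun s t => ?_⟩
  rw [Real.coe_toNNReal _ (by positivity), dist_eq_norm, Real.dist_eq, H_eq, H_eq]
  exact norm_bentLine_sub_le _ _ _ _

theorem exists_lipschitzWith_reducedField [NeZero m] (S : SFOCF k m) (hS : S.IsGloballyStable) :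
    ∃ K, LipschitzWith K S.reducedField := by
  obtain ⟨K₁, h₁⟩ := exists_lipschitzWith_bentLine_shift m (S.bL 0) (S.bR 0) (S.μ • eLast m)
  obtain ⟨K₂, h₂⟩ := S.exists_lipschitzWith_H
  exact ⟨_, by
    simpa only [funext (S.reducedField_eq hS), Function.comp_def, id] using h₁.comp
      (((lipschitzWith_apply_zero k).comp (h₂.comp (lipschitzWith_apply_zero m))).prodMk
        LipschitzWith.id)⟩

theorem exists_lipschitzWith_field [NeZero m] (S : SFOCF k m) (ε : ℝ) :
    ∃ K, LipschitzWith K (S.field ε) := by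
  obtain ⟨K₁, h₁⟩ := S.exists_lipschitzWith_fastField ε
  obtain ⟨K₂, h₂⟩ := exists_lipschitzWith_bentLine_shift m (S.bL ε) (S.bR ε) (S.μ • eLast m)
  have hfast := h₁.comp (((lipschitzWith_apply_zero m).comp
    (LipschitzWith.prod_snd (α := EuclideanSpace ℝ (Fin k)))).prodMk LipschitzWith.prod_fst)
  have hslow := h₂.comp (((lipschitzWith_apply_zero k).comp
    (LipschitzWith.prod_fst (β := EuclideanSpace ℝ (Fin m)))).prodMk LipschitzWith.prod_snd)
  have hslow' := (lipschitzWith_smul (β := EuclideanSpace ℝ (Fin m)) ε).comp hslow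
  have := hfast.prodMk hslow'
  simp only [Function.comp_def, ← slowField_eq] at this
  exact ⟨_, this⟩

theorem layerField_eq_of_nonneg (S : SFOCF k m) (hS : S.IsGloballyStable) {y₁ : ℝ} (hy : 0 ≤ y₁)
    {ξ : EuclideanSpace ℝ (Fin k)} (hx : 0 ≤ (S.H y₁ + ξ) 0) :
    S.layerField y₁ (S.H y₁ + ξ) =
      Matrix.toEuclideanCLM (𝕜 := ℝ) (companionMatrix (S.aR 0)) ξ := by
  have hR := hS.hurwitzR.companion_last_pos
  have h0 : 0 ≤ S.H y₁ 0 := by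
    rw [H_apply_zero]
    split_ifs with h
    · rw [le_antisymm h hy]; simp
    · positivity
  have he := (hS.stable y₁).equilibrium
  rw [layerField, fastField_eq, bentLine_of_nonneg _ _ h0] at he
  -- Subtracting the equilibrium equation, written with the same linear piece, leaves the linear
  -- part acting on `ξ`.
  rw [← sub_zero (S.layerField y₁ _), ← he, layerField, fastField_eq, bentLine_of_nonneg _ _ hx,
    toEuclideanCLM_companionMatrix, map_add, PiLp.add_apply, add_smul]
  abel

theorem layerField_eq_of_nonpos (S : SFOCF k m) (hS : S.IsGloballyStable) {y₁ : ℝ} (hy : y₁ ≤ 0)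
    {ξ : EuclideanSpace ℝ (Fin k)} (hx : (S.H y₁ + ξ) 0 ≤ 0) :
    S.layerField y₁ (S.H y₁ + ξ) =
      Matrix.toEuclideanCLM (𝕜 := ℝ) (companionMatrix (S.aL 0)) ξ := by
  have hL := hS.hurwitzL.companion_last_pos
  have h0 : S.H y₁ 0 ≤ 0 := by
    rw [H_apply_zero, if_pos hy]
    exact div_nonpos_of_nonpos_of_nonneg hy hL.le
  have he := (hS.stable y₁).equilibrium
  rw [layerField, fastField_eq, bentLine_of_nonpos _ _ h0] at he
  rw [← sub_zero (S.layerField y₁ _), ← he, layerField, fastField_eq, bentLine_of_nonpos _ _ hx,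
    toEuclideanCLM_companionMatrix, map_add, PiLp.add_apply, add_smul]
  abel

/-- For `y₁ = ±1` the layer field is linear near its equilibrium. -/
theorem exists_layerField_smul (S : SFOCF k m) (hS : S.IsGloballyStable) {y₁ : ℝ} (hy : |y₁| = 1) :
    ∃ ρ : ℝ, 0 < ρ ∧ ∀ (c : ℝ) (ξ : EuclideanSpace ℝ (Fin k)), ‖ξ‖ ≤ ρ → ‖c • ξ‖ ≤ ρ →
      S.layerField y₁ (S.H y₁ + c • ξ) = c • S.layerField y₁ (S.H y₁ + ξ) := by
  have hL := hS.hurwitzL.companion_last_pos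
  have hR := hS.hurwitzR.companion_last_pos
  rcases eq_or_eq_neg_of_abs_eq hy with rfl | rfl
  · have h0 : S.H 1 0 = 1 / S.aR 0 (lastIdx k) := by
      rw [H_apply_zero, if_neg (by norm_num)]
    -- The radius is the distance from `H(1)` to the switching plane.
    refine ⟨1 / S.aR 0 (lastIdx k), by positivity, fun c ξ hξ hcξ => ?_⟩
    have key : ∀ ξ : EuclideanSpace ℝ (Fin k), ‖ξ‖ ≤ 1 / S.aR 0 (lastIdx k) →
        0 ≤ (S.H 1 + ξ) 0 := fun ξ h => by
      have h1 := (PiLp.norm_apply_le ξ 0).trans h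
      rw [PiLp.add_apply, h0]
      linarith [(abs_le.1 h1).1]
    rw [S.layerField_eq_of_nonneg hS zero_le_one (key _ hξ),
      S.layerField_eq_of_nonneg hS zero_le_one (key _ hcξ), map_smul]
  · have h0 : S.H (-1) 0 = -(1 / S.aL 0 (lastIdx k)) := by
      rw [H_apply_zero, if_pos (by norm_num), neg_div]
    refine ⟨1 / S.aL 0 (lastIdx k), by positivity, fun c ξ hξ hcξ => ?_⟩
    have key : ∀ ξ : EuclideanSpace ℝ (Fin k), ‖ξ‖ ≤ 1 / S.aL 0 (lastIdx k) →
        (S.H (-1) + ξ) 0 ≤ 0 := fun ξ h => by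
      have h1 := (PiLp.norm_apply_le ξ 0).trans h
      rw [PiLp.add_apply, h0]
      linarith [(abs_le.1 h1).2]
    rw [S.layerField_eq_of_nonpos hS (by norm_num) (key _ hξ),
      S.layerField_eq_of_nonpos hS (by norm_num) (key _ hcξ), map_smul]

/-- Orbits of the layer equations near `H (±1)` can be dilated. -/
theorem exists_dilation (S : SFOCF k m) (hS : S.IsGloballyStable) {y₁ : ℝ} (hy : |y₁| = 1) :
    ∃ r : ℝ, 0 < r ∧ ∀ {c : ℝ} {x : ℝ → EuclideanSpace ℝ (Fin k)}, 1 ≤ c →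
      IsForwardOrbit (S.layerField y₁) x → ‖c • (x 0 - S.H y₁)‖ ≤ r →
      IsForwardOrbit (S.layerField y₁) fun t => S.H y₁ + c • (x t - S.H y₁) := by
  obtain ⟨ρ, hρ, hlin⟩ := S.exists_layerField_smul hS hy
  obtain ⟨δ, hδ, hstab⟩ := (hS.stable y₁).lyapunov ρ hρ
  obtain ⟨K, hK⟩ := S.exists_lipschitzWith_fastField 0
  have hK' : LipschitzWith K (S.layerField y₁) := LipschitzWith.of_dist_le_mul fun a b => by
    simpa [Prod.dist_eq, layerField] using hK.dist_le_mul (y₁, a) (y₁, b)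
  refine ⟨δ / 2, by positivity, fun {c x} hc hx hr => ?_⟩
  have hc0 : 0 < c := zero_lt_one.trans_le hc
  -- The dilate of `x` is not known to stay where the field is linear. The orbit `w` from the
  -- dilated initial point does, by Lyapunov stability; shrinking it by `c⁻¹ ≤ 1` gives an orbit,
  -- which uniqueness identifies with `x`.
  obtain ⟨w, hw, hw0⟩ := hK'.exists_isForwardOrbit (S.H y₁ + c • (x 0 - S.H y₁))
  have hwρ : ∀ t, 0 ≤ t → ‖w t - S.H y₁‖ < ρ :=
    hstab w hw (by rw [hw0, add_sub_cancel_left]; linarith)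
  have hu : IsForwardOrbit (S.layerField y₁) fun t => S.H y₁ + c⁻¹ • (w t - S.H y₁) := by
    intro t ht
    rw [hlin c⁻¹ (w t - S.H y₁) (hwρ t ht).le (by
      rw [norm_smul, norm_inv, Real.norm_of_nonneg hc0.le]
      calc c⁻¹ * ‖w t - S.H y₁‖ ≤ 1 * ‖w t - S.H y₁‖ := by
            gcongr; exact inv_le_one_of_one_le₀ hc
        _ ≤ ρ := by rw [one_mul]; exact (hwρ t ht).le), add_sub_cancel]
    exact (((hw t ht).sub_const _).const_smul c⁻¹).const_add _
  have hxu : ∀ t, 0 ≤ t → x t = S.H y₁ + c⁻¹ • (w t - S.H y₁) := fun t ht =>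
    hx.eq_of_eq hK' hu (by rw [hw0, add_sub_cancel_left, inv_smul_smul₀ hc0.ne', add_sub_cancel]) ht
  have hw' : ∀ t, 0 ≤ t → S.H y₁ + c • (x t - S.H y₁) = w t := fun t ht => by
    rw [hxu t ht, add_sub_cancel_left, smul_inv_smul₀ hc0.ne', add_sub_cancel]
  intro t ht
  simp only [hw' t ht]
  exact (hw t ht).congr (fun s hs => hw' s hs) (hw' t ht)

theorem IsGloballyStable.isHomogeneousLayer {S : SFOCF k m} (hS : S.IsGloballyStable) :
    IsHomogeneousLayer S.layerField S.H where
  lipschitz := S.exists_lipschitzWith_fastField 0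
  field_smul := by
    intro c hc y x
    rw [layerField, layerField, fastField_eq, fastField_eq, map_smul, PiLp.smul_apply, smul_eq_mul,
      bentLine_mul _ _ hc, smul_add, smul_sub, mul_smul]
  continuous := S.continuous_H
  smul := by
    intro c hc y
    rw [H_eq, H_eq, bentLine_mul _ _ hc]
  equilibrium := fun y => (hS.stable y).equilibrium
  attracting := fun {y x} hx => (hS.stable y).attracting x hx
  dilation := by
    obtain ⟨r, hr, h⟩ := S.exists_dilation hS (y₁ := 1) (by simp)
    obtain ⟨r', hr', h'⟩ := S.exists_dilation hS (y₁ := -1) (by simp)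
    refine ⟨min r r', lt_min hr hr', fun {y c x} hy hc hx hcx => ?_⟩
    rcases eq_or_eq_neg_of_abs_eq hy with rfl | rfl
    · exact h hc hx (hcx.trans (min_le_left _ _))
    · exact h' hc hx (hcx.trans (min_le_right _ _))

end SFOCF

/-! ### Strong trapping regions -/

theorem eventually_lt_of_hasDerivWithinAt_neg {u : ℝ → ℝ} {u' t₀ : ℝ}
    (hu : HasDerivWithinAt u u' (Ici t₀) t₀) (hneg : u' < 0) : ∀ᶠ t in 𝓝[>] t₀, u t < u t₀ := by
  have h := (hasDerivWithinAt_iff_tendsto_slope' (by simp)).1 (hu.mono Ioi_subset_Ici_self)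
  filter_upwards [h.eventually (gt_mem_nhds hneg), self_mem_nhdsWithin] with t ht ht'
  rw [slope_def_field, div_neg_iff] at ht
  have : 0 < t - t₀ := sub_pos.2 ht'
  rcases ht with ht | ht <;> linarith

section Trapping

variable {F : Type*} [NormedAddCommGroup F] [NormedSpace ℝ F]

theorem IsLocalDefiningFunction.hasFDerivAt {Ω U : Set F} {p q : F} {h : F → ℝ}
    (hd : IsLocalDefiningFunction Ω p U h) (hq : q ∈ U) : HasFDerivAt h (fderiv ℝ h q) q :=
  ((hd.smooth.contDiffAt (hd.isOpen.mem_nhds hq)).differentiableAt (by simp)).hasFDerivAt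

theorem IsLocalDefiningFunction.nonneg_of_mem_frontier {Ω U : Set F} {p : F} {h : F → ℝ}
    (hd : IsLocalDefiningFunction Ω p U h) (hp : p ∈ frontier Ω) : 0 ≤ h p := by
  by_contra! hneg
  refine hp.2 (mem_interior_iff_mem_nhds.2 ?_)
  filter_upwards [(hd.hasFDerivAt hd.mem).continuousAt.eventually (gt_mem_nhds hneg),
    hd.isOpen.mem_nhds hd.mem] with q hq hqU
  have : q ∈ Ω ∩ U := by
    rw [hd.inter_eq]
    exact ⟨hqU, hq.le⟩
  exact this.1

theorem IsLocalDefiningFunction.eventually_mem {Ω U : Set F} {p q v : F} {h : F → ℝ}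
    (hd : IsLocalDefiningFunction Ω p U h) (hqU : q ∈ U) (hq : h q ≤ 0)
    (hv : fderiv ℝ h q v < 0) {y : ℝ → F} {t₀ : ℝ} (hy : HasDerivWithinAt y v (Ici t₀) t₀)
    (hyq : y t₀ = q) : ∀ᶠ t in 𝓝[>] t₀, y t ∈ Ω := by
  subst hyq
  have hder : HasDerivWithinAt (h ∘ y) (fderiv ℝ h (y t₀) v) (Ici t₀) t₀ :=
    (hd.hasFDerivAt hqU).comp_hasDerivWithinAt t₀ hy
  have hU : ∀ᶠ t in 𝓝[>] t₀, y t ∈ U :=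
    (hy.continuousWithinAt.mono Ioi_subset_Ici_self).eventually (hd.isOpen.mem_nhds hqU)
  filter_upwards [eventually_lt_of_hasDerivWithinAt_neg hder hv, hU] with t ht htU
  have : y t ∈ Ω ∩ U := by
    rw [hd.inter_eq]
    exact ⟨htU, (ht.trans_le hq).le⟩
  exact this.1

/-- On the boundary of a strong trapping region the field points strictly inwards. -/
theorem IsStrongTrappingRegion.fderiv_neg [CompleteSpace F] {g : F → F} {Ω U : Set F} {p : F}
    {h : F → ℝ} (hΩ : IsStrongTrappingRegion g Ω) {K : NNReal} (hg : LipschitzWith K g)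
    (hp : p ∈ frontier Ω) (hd : IsLocalDefiningFunction Ω p U h) : fderiv ℝ h p (g p) < 0 := by
  refine lt_of_le_of_ne ?_ fun h0 => hΩ.not_tangent p hp ⟨U, h, hd, h0⟩
  -- Were the derivative positive, `h` would become positive along the orbit from `p`, which would
  -- leave `Ω`.
  by_contra! hpos
  obtain ⟨y, hy, rfl⟩ := hg.exists_isForwardOrbit p
  have hmem := hΩ.trapping y hy (hΩ.isCompact.isClosed.frontier_subset hp)
  have hder : HasDerivWithinAt (h ∘ y) (fderiv ℝ h (y 0) (g (y 0))) (Ici 0) 0 :=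
    (hd.hasFDerivAt hd.mem).comp_hasDerivWithinAt 0 (hy 0 le_rfl)
  have hU : ∀ᶠ t in 𝓝[>] (0 : ℝ), y t ∈ U :=
    ((hy 0 le_rfl).continuousWithinAt.mono Ioi_subset_Ici_self).eventually
      (hd.isOpen.mem_nhds hd.mem)
  obtain ⟨t, ⟨ht, htU⟩, ht0⟩ := ((eventually_lt_of_hasDerivWithinAt_neg hder.neg
    (neg_neg_of_pos hpos)).and hU |>.and self_mem_nhdsWithin).exists
  have hle : y t ∈ Ω ∩ U := ⟨hmem t (le_of_lt ht0), htU⟩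
  rw [hd.inter_eq] at hle
  have h1 := hd.nonneg_of_mem_frontier hp
  have h2 := hle.2
  simp only [Pi.neg_apply, Function.comp_apply] at ht
  linarith

/-- Curves whose velocity is uniformly close to a strongly trapped field do not leave the trapping
region. -/
theorem IsStrongTrappingRegion.exists_robust [CompleteSpace F] {g : F → F} {Ω : Set F}
    (hΩ : IsStrongTrappingRegion g Ω) {K : NNReal} (hg : LipschitzWith K g) :
    ∃ r : ℝ, 0 < r ∧ ∀ {y : ℝ → F} {t₀ c : ℝ} {v : F}, y t₀ ∈ Ω → 0 < c →
      HasDerivWithinAt y (c • v) (Ici t₀) t₀ → ‖v - g (y t₀)‖ < r → ∀ᶠ t in 𝓝[>] t₀, y t ∈ Ω := by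
  -- Membership is doubled so that compactness induction varies the first set while the second stays
  -- `Ω`.
  suffices ∃ r : ℝ, 0 < r ∧ ∀ {y : ℝ → F} {t₀ c : ℝ} {v : F}, y t₀ ∈ Ω → y t₀ ∈ Ω → 0 < c →
      HasDerivWithinAt y (c • v) (Ici t₀) t₀ → ‖v - g (y t₀)‖ < r → ∀ᶠ t in 𝓝[>] t₀, y t ∈ Ω by
    obtain ⟨r, hr, h⟩ := this
    exact ⟨r, hr, fun h0 => h h0 h0⟩
  refine hΩ.isCompact.induction_on (p := fun Q => ∃ r : ℝ, 0 < r ∧ ∀ {y : ℝ → F} {t₀ c : ℝ} {v : F},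
    y t₀ ∈ Q → y t₀ ∈ Ω → 0 < c → HasDerivWithinAt y (c • v) (Ici t₀) t₀ → ‖v - g (y t₀)‖ < r →
      ∀ᶠ t in 𝓝[>] t₀, y t ∈ Ω) ⟨1, one_pos, fun h => h.elim⟩ ?_ ?_ ?_
  · rintro s t hst ⟨r, hr, h⟩
    exact ⟨r, hr, fun hm => h (hst hm)⟩
  · rintro s t ⟨r, hr, h⟩ ⟨r', hr', h'⟩
    refine ⟨min r r', lt_min hr hr', fun hm hΩ hc hy hv => ?_⟩
    rcases hm with hm | hm
    · exact h hm hΩ hc hy (hv.trans_le (min_le_left _ _))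
    · exact h' hm hΩ hc hy (hv.trans_le (min_le_right _ _))
  · intro p hp
    by_cases hint : p ∈ interior Ω
    · refine ⟨interior Ω, mem_nhdsWithin_of_mem_nhds (isOpen_interior.mem_nhds hint), 1, one_pos,
        fun hm _ _ hy _ => ?_⟩
      filter_upwards [(hy.continuousWithinAt.mono Ioi_subset_Ici_self).eventually
        (isOpen_interior.mem_nhds hm)] with t ht
      exact interior_subset ht
    · have hfr : p ∈ frontier Ω := ⟨subset_closure hp, hint⟩
      obtain ⟨U, h, hd⟩ := hΩ.smoothBoundary p hfr
      have hneg := hΩ.fderiv_neg hg hfr hd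
      -- Joint continuity in base point and vector keeps `dh` negative for all points near `p` and
      -- velocities near `g p`.
      have hcont : ContinuousAt (fun a : F × F => fderiv ℝ h a.1 a.2) (p, g p) := by
        have h1 : ContinuousAt (fderiv ℝ h) p :=
          (hd.smooth.continuousOn_fderiv_of_isOpen hd.isOpen (by simp)).continuousAt
            (hd.isOpen.mem_nhds hd.mem)
        have h2 : ContinuousAt (fun a : F × F => fderiv ℝ h a.1) (p, g p) :=
          ContinuousAt.comp (x := (p, g p)) (f := Prod.fst) h1 continuousAt_fst
        exact h2.clm_apply continuousAt_snd
      obtain ⟨ρ, hρ, hball⟩ := Metric.eventually_nhds_iff.1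
        (hcont.eventually (gt_mem_nhds hneg))
      have hnear : ∀ᶠ q in 𝓝 p, dist q p < ρ ∧ dist (g q) (g p) < ρ / 2 ∧ q ∈ U := by
        filter_upwards [Metric.ball_mem_nhds p hρ, hg.continuous.continuousAt.eventually
          (Metric.ball_mem_nhds (g p) (half_pos hρ)), hd.isOpen.mem_nhds hd.mem] with q h1 h2 h3
        exact ⟨h1, h2, h3⟩
      refine ⟨_, mem_nhdsWithin_of_mem_nhds hnear, ρ / 2, half_pos hρ,
        fun {y t₀ c v} hm hmΩ hc hy hv => ?_⟩
      obtain ⟨h1, h2, hU⟩ := hm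
      have hle : y t₀ ∈ Ω ∩ U := ⟨hmΩ, hU⟩
      rw [hd.inter_eq] at hle
      refine hd.eventually_mem hU hle.2 (v := c • v) ?_ hy rfl
      have hlt : fderiv ℝ h (y t₀) v < 0 := hball (y := (y t₀, v)) (by
        rw [Prod.dist_eq]
        refine max_lt h1 ?_
        calc dist v (g p) ≤ dist v (g (y t₀)) + dist (g (y t₀)) (g p) := dist_triangle _ _ _
          _ < ρ / 2 + ρ / 2 := by rw [dist_eq_norm v]; gcongr
          _ = ρ := by ring)
      rw [map_smul, smul_eq_mul]
      exact mul_neg_of_pos_of_neg hc hlt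

/-- Continuous induction: an orbit stays in a closed set if it can always be continued in it. -/
theorem forall_mem_of_continuation {X : Type*} [TopologicalSpace X] {Q : Set X} (hQ : IsClosed Q)
    {z : ℝ → X} (hz : ContinuousOn z (Ici 0)) (h0 : z 0 ∈ Q)
    (hstep : ∀ t, 0 ≤ t → (∀ s ∈ Icc 0 t, z s ∈ Q) → ∀ᶠ s in 𝓝[>] t, z s ∈ Q) {t : ℝ}
    (ht : 0 ≤ t) : z t ∈ Q := by
  by_contra hcon
  -- At the infimum of the bad times the orbit is still in `Q` by closedness, and the continuation
  -- hypothesis then excludes bad times just after it.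
  set A : Set ℝ := {s | 0 ≤ s ∧ z s ∉ Q} with hA
  have hAne : A.Nonempty := ⟨t, ht, hcon⟩
  have hAbd : BddBelow A := ⟨0, fun s hs => hs.1⟩
  have hs0 : 0 ≤ sInf A := le_csInf hAne fun s hs => hs.1
  have hlt : ∀ s, 0 ≤ s → s < sInf A → z s ∈ Q := fun s hs hsA => by
    by_contra hc
    exact absurd (csInf_le hAbd ⟨hs, hc⟩) (not_le.2 hsA)
  have hmem : z (sInf A) ∈ Q := by
    rcases hs0.eq_or_lt with h | h
    · rwa [← h]
    · have hc : ContinuousWithinAt z (Ico 0 (sInf A)) (sInf A) :=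
        (hz _ hs0).mono Ico_subset_Ici_self
      have hcl : sInf A ∈ closure (Ico 0 (sInf A)) := by
        rw [closure_Ico h.ne]
        exact ⟨hs0, le_rfl⟩
      have := hc.mem_closure hcl (t := Q) (fun s hs => hlt s hs.1 hs.2)
      rwa [hQ.closure_eq] at this
  have hev := hstep _ hs0 fun s hs => by
    rcases hs.2.eq_or_lt with h | h
    · rwa [h]
    · exact hlt s hs.1 h
  obtain ⟨u, hu, hsub⟩ := mem_nhdsGT_iff_exists_Ioo_subset.1 hev
  obtain ⟨s, hsA, hsu⟩ := exists_lt_of_csInf_lt hAne hu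
  rcases (csInf_le hAbd hsA).eq_or_lt with h | h
  · exact hsA.2 (h ▸ hmem)
  · exact hsA.2 (hsub ⟨h, hsu⟩)

end Trapping

/-! ### Comparison of the slow-fast system with its layer and reduced systems. -/

theorem HasDerivWithinAt.fst_comp {E F : Type*} [NormedAddCommGroup E] [NormedSpace ℝ E]
    [NormedAddCommGroup F] [NormedSpace ℝ F] {z : ℝ → E × F} {z' : E × F} {s : Set ℝ} {t : ℝ}
    (h : HasDerivWithinAt z z' s t) : HasDerivWithinAt (fun t => (z t).1) z'.1 s t :=
  (ContinuousLinearMap.fst ℝ E F).hasFDerivAt.comp_hasDerivWithinAt t h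

theorem HasDerivWithinAt.snd_comp {E F : Type*} [NormedAddCommGroup E] [NormedSpace ℝ E]
    [NormedAddCommGroup F] [NormedSpace ℝ F] {z : ℝ → E × F} {z' : E × F} {s : Set ℝ} {t : ℝ}
    (h : HasDerivWithinAt z z' s t) : HasDerivWithinAt (fun t => (z t).2) z'.2 s t :=
  (ContinuousLinearMap.snd ℝ E F).hasFDerivAt.comp_hasDerivWithinAt t h

theorem ContDiffOn.exists_norm_sub_le {V : Type*} [NormedAddCommGroup V] [NormedSpace ℝ V]
    {u : ℝ → V} {ε₁ : ℝ} (hu : ContDiffOn ℝ 1 u (Icc 0 ε₁)) (hε₁ : 0 < ε₁) :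
    ∃ C : ℝ, ∀ᶠ ε in 𝓝[>] (0 : ℝ), ‖u ε - u 0‖ ≤ C * ε := by
  obtain ⟨C, hC⟩ := (hu.differentiableOn (by simp) 0
    ⟨le_rfl, hε₁.le⟩).hasDerivWithinAt.isBigO_sub.bound
  rw [prod_pure, eventually_map] at hC
  refine ⟨C, ?_⟩
  filter_upwards [hC.filter_mono (nhdsWithin_le_of_mem (Icc_mem_nhdsGT hε₁)),
    self_mem_nhdsWithin] with ε h hε
  rwa [sub_zero, Real.norm_of_nonneg (le_of_lt hε)] at h

namespace SFOCF

variable {k m : ℕ}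

theorem IsC1On.exists_norm_sub_le {S : SFOCF k m} {ε₁ : ℝ} (hS : S.IsC1On ε₁) (hε₁ : 0 < ε₁) :
    ∃ C : ℝ, 0 ≤ C ∧ ∀ᶠ ε in 𝓝[>] (0 : ℝ),
      ‖S.aL ε - S.aL 0‖ + ‖S.aR ε - S.aR 0‖ ≤ C * ε ∧
        ‖S.bL ε - S.bL 0‖ + ‖S.bR ε - S.bR 0‖ ≤ C * ε := by
  obtain ⟨C₁, h₁⟩ := hS.aL.exists_norm_sub_le hε₁
  obtain ⟨C₂, h₂⟩ := hS.aR.exists_norm_sub_le hε₁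
  obtain ⟨C₃, h₃⟩ := hS.bL.exists_norm_sub_le hε₁
  obtain ⟨C₄, h₄⟩ := hS.bR.exists_norm_sub_le hε₁
  refine ⟨|C₁| + |C₂| + |C₃| + |C₄|, by positivity, ?_⟩
  filter_upwards [h₁, h₂, h₃, h₄, self_mem_nhdsWithin] with ε h₁ h₂ h₃ h₄ hε
  have hε : 0 < ε := hε
  have k₁ := mul_le_mul_of_nonneg_right (le_abs_self C₁) hε.le
  have k₂ := mul_le_mul_of_nonneg_right (le_abs_self C₂) hε.le
  have k₃ := mul_le_mul_of_nonneg_right (le_abs_self C₃) hε.le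
  have k₄ := mul_le_mul_of_nonneg_right (le_abs_self C₄) hε.le
  have := norm_nonneg (S.aL ε - S.aL 0)
  have := norm_nonneg (S.aR ε - S.aR 0)
  have := norm_nonneg (S.bL ε - S.bL 0)
  have := norm_nonneg (S.bR ε - S.bR 0)
  constructor <;> linarith

/-- The error has two sources: the coefficients differ from those at `ε = 0`, and `x` lies off the
critical manifold. -/
theorem norm_slowField_sub_reducedField_le [NeZero k] [NeZero m] (S : SFOCF k m) (hS : S.IsGloballyStable)
    (ε : ℝ) (z : EuclideanSpace ℝ (Fin k) × EuclideanSpace ℝ (Fin m)) :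
    ‖S.slowField ε z - S.reducedField z.2‖ ≤
      |z.1 0| * (‖S.bL ε - S.bL 0‖ + ‖S.bR ε - S.bR 0‖) +
        (‖S.bL 0‖ + ‖S.bR 0‖) * ‖z.1 - S.H (z.2 0)‖ := by
  have h1 := norm_bentLine_sub_bentLine_le (S.bL ε) (S.bR ε) (S.bL 0) (S.bR 0) (z.1 0)
  have h2 := norm_bentLine_sub_le (S.bL 0) (S.bR 0) (z.1 0) (S.H (z.2 0) 0)
  have h3 : |z.1 0 - S.H (z.2 0) 0| ≤ ‖z.1 - S.H (z.2 0)‖ :=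
    PiLp.norm_apply_le (z.1 - S.H (z.2 0)) 0
  have : S.slowField ε z - S.reducedField z.2 =
      -((bentLine (S.bL ε) (S.bR ε) (z.1 0) - bentLine (S.bL 0) (S.bR 0) (z.1 0)) +
        (bentLine (S.bL 0) (S.bR 0) (z.1 0) - bentLine (S.bL 0) (S.bR 0) (S.H (z.2 0) 0))) := by
    rw [slowField_eq, reducedField_eq S hS]; abel
  rw [this, norm_neg]
  exact (norm_add_le _ _).trans (add_le_add h1 (h2.trans (by gcongr)))

theorem norm_fastField_sub_layerField_le [NeZero k] (S : SFOCF k m) (ε y₁ y₁' : ℝ)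
    (x : EuclideanSpace ℝ (Fin k)) :
    ‖S.fastField ε y₁ x - S.layerField y₁' x‖ ≤
      |y₁ - y₁'| + |x 0| * (‖S.aL ε - S.aL 0‖ + ‖S.aR ε - S.aR 0‖) := by
  have h1 := norm_bentLine_sub_bentLine_le (S.aL ε) (S.aR ε) (S.aL 0) (S.aR 0) (x 0)
  have : S.fastField ε y₁ x - S.layerField y₁' x = (y₁ - y₁') • eLast k -
      (bentLine (S.aL ε) (S.aR ε) (x 0) - bentLine (S.aL 0) (S.aR 0) (x 0)) := by
    rw [layerField, fastField_eq, fastField_eq, sub_smul]; abel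
  rw [this]
  refine (norm_sub_le _ _).trans (add_le_add ?_ h1)
  simp [norm_smul, eLast]

/-- Along orbits in the tube of radius one, the slow dynamics is close to the reduced system, and
the distance to the critical manifold is halved in a fixed time up to an error of order `ε`. -/
theorem exists_tube_estimates [NeZero k] [NeZero m] (S : SFOCF k m) {ε₁ : ℝ} (hε₁ : 0 < ε₁)
    (hS : S.IsC1On ε₁) (hstable : S.IsGloballyStable) {Ω : Set (EuclideanSpace ℝ (Fin m))}
    (hΩ : IsCompact Ω) :
    ∃ T B C D : ℝ, 0 < T ∧ 0 ≤ B ∧ 1 ≤ C ∧ 0 ≤ D ∧ ∀ᶠ ε in 𝓝[>] (0 : ℝ),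
      (∀ z ∈ S.tube Ω 1, ‖S.slowField ε z - S.reducedField z.2‖ ≤
        B * (ε + ‖z.1 - S.H (z.2 0)‖)) ∧
      ∀ z : ℝ → EuclideanSpace ℝ (Fin k) × EuclideanSpace ℝ (Fin m),
        IsForwardOrbit (S.field ε) z → ∀ t ∈ Icc 0 T, (∀ s ∈ Icc 0 t, z s ∈ S.tube Ω 1) →
          ‖(z t).1 - S.H ((z t).2 0)‖ ≤ C * ‖(z 0).1 - S.H ((z 0).2 0)‖ + D * ε ∧
          (t = T → ‖(z t).1 - S.H ((z t).2 0)‖ ≤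
            1 / 2 * ‖(z 0).1 - S.H ((z 0).2 0)‖ + D * ε) := by
  obtain ⟨A, hA, hcoef⟩ := hS.exists_norm_sub_le hε₁
  have hlayer := hstable.isHomogeneousLayer
  obtain ⟨T, C, hT, hC, hcontr⟩ := hlayer.exists_uniform_contraction
  obtain ⟨K, hK⟩ := hlayer.exists_lipschitzWith
  obtain ⟨Cg, hCg1, hCg⟩ := exists_dist_le_of_approx_orbit (E := EuclideanSpace ℝ (Fin k)) K hT.le
  obtain ⟨L, hL⟩ := S.exists_lipschitzWith_H
  obtain ⟨Kr, hKr⟩ := S.exists_lipschitzWith_reducedField hstable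
  obtain ⟨G₀, hG₀⟩ := (hΩ.image hKr.continuous).isBounded.exists_norm_le
  have hHc : Continuous fun y : EuclideanSpace ℝ (Fin m) => S.H (y 0) :=
    S.continuous_H.comp (lipschitzWith_apply_zero m).continuous
  obtain ⟨X₀, hX₀⟩ := (hΩ.image hHc).isBounded.exists_norm_le
  -- The absolute value matters when `Ω` is empty, since the bound then has no sign; `1` is the
  -- radius of the tube.
  set X : ℝ := |X₀| + 1 with hX
  have hXpos : 0 < X := by positivity
  have hxX : ∀ z ∈ S.tube Ω 1, |z.1 0| ≤ X := fun z hz => by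
    have h1 : ‖S.H (z.2 0)‖ ≤ X₀ := hX₀ _ ⟨z.2, hz.2, rfl⟩
    have h2 : |z.1 0| ≤ ‖z.1‖ := PiLp.norm_apply_le z.1 0
    have h3 : ‖z.1‖ ≤ ‖z.1 - S.H (z.2 0)‖ + ‖S.H (z.2 0)‖ := by
      simpa using norm_add_le (z.1 - S.H (z.2 0)) (S.H (z.2 0))
    have h4 : ‖z.1 - S.H (z.2 0)‖ ≤ 1 := hz.1
    linarith [le_abs_self X₀]
  set b : ℝ := ‖S.bL 0‖ + ‖S.bR 0‖ with hb
  have hb0 : 0 ≤ b := by positivity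
  set B : ℝ := X * A + b with hB
  have hB0 : 0 ≤ B := by positivity
  set G : ℝ := |G₀| + 2 * B with hG
  have hG0 : 0 ≤ G := by positivity
  set η : ℝ := G * T + X * A with hη
  have hη0 : 0 ≤ η := by positivity
  -- The two terms of `D` are the Grönwall error and the displacement of `H(y₁)` as `y₁` drifts.
  refine ⟨T, B, C, Cg * η + L * (G * T), hT, hB0, hC, by positivity, ?_⟩
  filter_upwards [hcoef, self_mem_nhdsWithin, Ioo_mem_nhdsGT (zero_lt_one (α := ℝ))]
    with ε hε hεpos hεlt
  replace hεpos : 0 < ε := hεpos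
  have hslow : ∀ z ∈ S.tube Ω 1, ‖S.slowField ε z - S.reducedField z.2‖ ≤
      B * (ε + ‖z.1 - S.H (z.2 0)‖) := fun z hz => by
    refine (S.norm_slowField_sub_reducedField_le hstable ε z).trans ?_
    have h1 := mul_le_mul (hxX z hz) hε.2 (by positivity) hXpos.le
    have h2 := mul_nonneg hb0 hεpos.le
    have h3 := mul_nonneg (mul_nonneg hXpos.le hA) (norm_nonneg (z.1 - S.H (z.2 0)))
    rw [hB]
    nlinarith
  refine ⟨hslow, fun z hz t ht htube => ?_⟩
  have hslowG : ∀ s ∈ Icc 0 t, ‖ε • S.slowField ε (z s)‖ ≤ ε * G := fun s hs => by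
    have h1 := hslow _ (htube s hs)
    have h2 : ‖S.reducedField (z s).2‖ ≤ G₀ := hG₀ _ ⟨_, (htube s hs).2, rfl⟩
    have h3 : ‖(z s).1 - S.H ((z s).2 0)‖ ≤ 1 := (htube s hs).1
    have h4 : ‖S.slowField ε (z s)‖ ≤ ‖S.slowField ε (z s) - S.reducedField (z s).2‖ +
        ‖S.reducedField (z s).2‖ := by
      simpa using norm_add_le (S.slowField ε (z s) - S.reducedField (z s).2)
        (S.reducedField (z s).2)
    have h5 : B * (ε + ‖(z s).1 - S.H ((z s).2 0)‖) ≤ B * 2 := by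
      gcongr
      linarith [hεlt.2]
    rw [norm_smul, Real.norm_of_nonneg hεpos.le]
    gcongr
    linarith [le_abs_self G₀]
  have hderiv : ∀ s, 0 ≤ s → HasDerivWithinAt (fun s => (z s).1)
      (S.fastField ε ((z s).2 0) (z s).1) (Ici 0) s ∧
      HasDerivWithinAt (fun s => (z s).2) (ε • S.slowField ε (z s)) (Ici 0) s := fun s hs =>
    ⟨(hz s hs).fst_comp, (hz s hs).snd_comp⟩
  have hdrift : ∀ s ∈ Icc 0 t, |(z s).2 0 - (z 0).2 0| ≤ ε * (G * T) := fun s hs => by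
    have h1 := (convex_Icc (0 : ℝ) t).norm_image_sub_le_of_norm_hasDerivWithin_le
      (f := fun s => (z s).2) (f' := fun s => ε • S.slowField ε (z s))
      (fun s hs => ((hderiv s hs.1).2).mono Icc_subset_Ici_self) hslowG
      (left_mem_Icc.2 ht.1) hs
    have h2 : |(z s).2 0 - (z 0).2 0| ≤ ‖(z s).2 - (z 0).2‖ :=
      PiLp.norm_apply_le ((z s).2 - (z 0).2) 0
    refine h2.trans (h1.trans ?_)
    rw [sub_zero, Real.norm_of_nonneg hs.1, mul_assoc]
    gcongr
    exact hs.2.trans ht.2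
  have htt : t ∈ Icc 0 t := right_mem_Icc.2 ht.1
  -- The comparison orbit solves the layer equations with `y₁` frozen at its initial value.
  obtain ⟨w, hw, hw0⟩ := (hK ((z 0).2 0)).exists_isForwardOrbit (z 0).1
  have hcmp := hCg (hK ((z 0).2 0)) (z := w) (w := fun s => (z s).1)
    (w' := fun s => S.fastField ε ((z s).2 0) (z s).1) (η := ε * η) (t := t) (by positivity) ht hw
    (fun s hs => (hderiv s hs.1).1) (fun s hs => by
      refine (S.norm_fastField_sub_layerField_le ε _ _ _).trans ?_
      have h1 := mul_le_mul (hxX _ (htube s hs)) hε.1 (by positivity) hXpos.le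
      have h2 := hdrift s hs
      rw [hη]
      nlinarith)
  rw [hw0, sub_self, norm_zero, zero_add] at hcmp
  have hH : ‖S.H ((z 0).2 0) - S.H ((z t).2 0)‖ ≤ L * (ε * (G * T)) := by
    have h1 := hL.dist_le_mul ((z 0).2 0) ((z t).2 0)
    rw [dist_eq_norm, Real.dist_eq, abs_sub_comm] at h1
    exact h1.trans (by gcongr; exact hdrift t htt)
  have htri : ‖(z t).1 - S.H ((z t).2 0)‖ ≤ ‖w t - (z t).1‖ + ‖w t - S.H ((z 0).2 0)‖ +
      ‖S.H ((z 0).2 0) - S.H ((z t).2 0)‖ := by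
    have : (z t).1 - S.H ((z t).2 0) = -(w t - (z t).1) + (w t - S.H ((z 0).2 0)) +
      (S.H ((z 0).2 0) - S.H ((z t).2 0)) := by abel
    rw [this, ← norm_neg (w t - (z t).1)]
    exact (norm_add_le _ _).trans (by gcongr; exact norm_add_le _ _)
  obtain ⟨hc1, hc2⟩ := hcontr hw
  rw [hw0] at hc1 hc2
  refine ⟨?_, fun htT => ?_⟩
  · have := hc1 t ht
    nlinarith
  · rw [← htT] at hc2
    nlinarith

theorem isClosed_tube [NeZero k] [NeZero m] (S : SFOCF k m) {Ω : Set (EuclideanSpace ℝ (Fin m))}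
    (hΩ : IsClosed Ω) (δ : ℝ) : IsClosed (S.tube Ω δ) := by
  have h1 : Continuous fun z : EuclideanSpace ℝ (Fin k) × EuclideanSpace ℝ (Fin m) =>
      ‖z.1 - S.H (z.2 0)‖ :=
    (continuous_fst.sub (S.continuous_H.comp
      ((lipschitzWith_apply_zero m).continuous.comp continuous_snd))).norm
  exact (isClosed_le h1 continuous_const).inter (hΩ.preimage continuous_snd)

theorem tube_mono [NeZero k] [NeZero m] (S : SFOCF k m) (Ω : Set (EuclideanSpace ℝ (Fin m))) {δ δ' : ℝ}
    (h : δ ≤ δ') : S.tube Ω δ ⊆ S.tube Ω δ' :=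
  fun _ hz => ⟨hz.1.trans h, hz.2⟩

/-- Tubes of radius of order `ε` trap the orbits of the slow-fast system for small `ε`. -/
theorem exists_tube_trapping [NeZero k] [NeZero m] (S : SFOCF k m) {ε₁ : ℝ} (hε₁ : 0 < ε₁)
    (hS : S.IsC1On ε₁) (hstable : S.IsGloballyStable) {Ω : Set (EuclideanSpace ℝ (Fin m))}
    (hΩ : IsStrongTrappingRegion S.reducedField Ω) :
    ∃ M N K : ℝ, 0 < M ∧ M ≤ N ∧ ∀ᶠ ε in 𝓝[>] (0 : ℝ),
      (∀ z : ℝ → EuclideanSpace ℝ (Fin k) × EuclideanSpace ℝ (Fin m),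
        IsForwardOrbit (S.field ε) z → z 0 ∈ S.tube Ω (ε * M) →
          ∀ t : ℝ, 0 ≤ t → z t ∈ S.tube Ω (ε * N)) ∧
      ∀ z ∈ S.tube Ω (ε * N), ‖S.slowField ε z - S.reducedField z.2‖ ≤ K * ε := by
  obtain ⟨T, B, C, D, hT, hB, hC, hD, hest⟩ :=
    S.exists_tube_estimates hε₁ hS hstable hΩ.isCompact
  obtain ⟨Kr, hKr⟩ := S.exists_lipschitzWith_reducedField hstable
  obtain ⟨r, hr, hrobust⟩ := hΩ.exists_robust hKr
  -- With `M ≥ 2D`, halving and adding `Dε` maps `[0, εM]` into itself. The last summand of `N`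
  -- makes the bound by `εN` strict, which lets the orbit be continued.
  set M : ℝ := 2 * D + 1 with hM
  have hMpos : 0 < M := by positivity
  set N : ℝ := C * M + D + 1 with hN
  have hMN : M ≤ N := by nlinarith
  have hNpos : 0 < N := hMpos.trans_le hMN
  refine ⟨M, N, B * (1 + N), hMpos, hMN, ?_⟩
  have hsmall : ∀ᶠ ε in 𝓝[>] (0 : ℝ), ε * N < 1 ∧ B * (1 + N) * ε < r := by
    have h1 : Tendsto (fun ε : ℝ => ε * N) (𝓝[>] 0) (𝓝 0) := by
      have : Continuous fun ε : ℝ => ε * N := by fun_prop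
      simpa using (this.tendsto 0).mono_left nhdsWithin_le_nhds
    have h2 : Tendsto (fun ε : ℝ => B * (1 + N) * ε) (𝓝[>] 0) (𝓝 0) := by
      have : Continuous fun ε : ℝ => B * (1 + N) * ε := by fun_prop
      simpa using (this.tendsto 0).mono_left nhdsWithin_le_nhds
    exact (h1.eventually (gt_mem_nhds one_pos)).and (h2.eventually (gt_mem_nhds hr))
  filter_upwards [hest, hsmall, self_mem_nhdsWithin] with ε hε hεs hεpos
  replace hεpos : 0 < ε := hεpos
  obtain ⟨hslow, hstep⟩ := hε
  have hsub : S.tube Ω (ε * N) ⊆ S.tube Ω 1 := S.tube_mono Ω hεs.1.le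
  have hclose : ∀ z ∈ S.tube Ω (ε * N),
      ‖S.slowField ε z - S.reducedField z.2‖ ≤ B * (1 + N) * ε := fun z hz =>
    calc _ ≤ B * (ε + ‖z.1 - S.H (z.2 0)‖) := hslow z (hsub hz)
      _ ≤ B * (ε + ε * N) := by gcongr; exact hz.1
      _ = _ := by ring
  refine ⟨fun z hz hz0 t ht => ?_, hclose⟩
  refine forall_mem_of_continuation (S.isClosed_tube hΩ.isCompact.isClosed _) hz.continuousOn
    (S.tube_mono Ω (by gcongr) hz0) (fun t ht hist => ?_) ht
  have hgrid : ∀ n : ℕ, n * T ≤ t → ‖(z (n * T)).1 - S.H ((z (n * T)).2 0)‖ ≤ ε * M := by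
    intro n
    induction n with
    | zero => exact fun _ => by simpa using hz0.1
    | succ n ih =>
      intro hn
      push_cast at hn ⊢
      have hnT : 0 ≤ n * T := by positivity
      have h1 := (hstep _ (hz.shift hnT) T ⟨hT.le, le_rfl⟩ fun s hs =>
        hsub (hist _ ⟨by linarith [hs.1], by linarith [hs.2]⟩)).2 rfl
      have h2 := ih (by linarith)
      simp only [add_zero] at h1
      rw [add_mul, one_mul]
      calc _ ≤ _ := h1
        _ ≤ 1 / 2 * (ε * M) + D * ε := by gcongr
        _ ≤ ε * M := by rw [hM]; nlinarith
  have hlt : ‖(z t).1 - S.H ((z t).2 0)‖ < ε * N := by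
    set n : ℕ := ⌊t / T⌋₊ with hn
    have hle : n * T ≤ t := by
      rw [← le_div_iff₀ hT]
      exact Nat.floor_le (by positivity)
    have hlt : t < (n + 1) * T := by
      rw [← div_lt_iff₀ hT]
      exact Nat.lt_floor_add_one _
    have hnT : 0 ≤ n * T := by positivity
    have h1 := (hstep _ (hz.shift hnT) (t - n * T) ⟨by linarith, by linarith⟩ fun s hs =>
      hsub (hist _ ⟨by linarith [hs.1], by linarith [hs.2]⟩)).1
    have h2 := hgrid n hle
    simp only [add_zero, add_sub_cancel] at h1
    calc _ ≤ _ := h1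
      _ ≤ C * (ε * M) + D * ε := by gcongr
      _ < ε * N := by rw [hN]; nlinarith
  have hzt : z t ∈ S.tube Ω (ε * N) := hist t ⟨ht, le_rfl⟩
  have hzder : HasDerivWithinAt z (S.field ε (z t)) (Ici t) t :=
    (hz t ht).mono (Ici_subset_Ici.2 ht)
  have hyΩ : ∀ᶠ s in 𝓝[>] t, (z s).2 ∈ Ω :=
    hrobust (y := fun s => (z s).2) (v := S.slowField ε (z t)) hzt.2 hεpos hzder.snd_comp
      ((hclose _ hzt).trans_lt hεs.2)
  have hdist : Continuous fun z : EuclideanSpace ℝ (Fin k) × EuclideanSpace ℝ (Fin m) =>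
      ‖z.1 - S.H (z.2 0)‖ :=
    (continuous_fst.sub (S.continuous_H.comp
      ((lipschitzWith_apply_zero m).continuous.comp continuous_snd))).norm
  have hxd : ∀ᶠ s in 𝓝[>] t, ‖(z s).1 - S.H ((z s).2 0)‖ < ε * N :=
    (hdist.continuousAt.comp_continuousWithinAt
      (hzder.continuousWithinAt.mono Ioi_subset_Ici_self)).eventually (gt_mem_nhds hlt)
  filter_upwards [hyΩ, hxd] with s h1 h2
  exact ⟨h2.le, h1⟩

end SFOCF

theorem theorem4p1 {k m : ℕ} [NeZero k] [NeZero m] (S : SFOCF k m)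
    (ε₁ : ℝ) (hε₁ : 0 < ε₁) (hS : S.IsC1On ε₁) (hstable : S.IsGloballyStable)
    (Ω : Set (EuclideanSpace ℝ (Fin m))) (hΩ : IsStrongTrappingRegion S.reducedField Ω) :
    ∃ M N εmax K : ℝ, 0 < M ∧ M ≤ N ∧ 0 < εmax ∧ εmax ≤ ε₁ ∧
      ∀ ε : ℝ, 0 < ε → ε < εmax →
        -- every point of `Ω_{εM}` has a forward orbit, defined for all `t ≥ 0`, ...
        (∀ z₀ ∈ S.tube Ω (ε * M), ∃ z : ℝ → _, IsForwardOrbit (S.field ε) z ∧ z 0 = z₀) ∧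
        -- ... and every forward orbit from `Ω_{εM}` stays in `Ω_{εN}`
        (∀ z : ℝ → _, IsForwardOrbit (S.field ε) z → z 0 ∈ S.tube Ω (ε * M) →
          ∀ t : ℝ, 0 ≤ t → z t ∈ S.tube Ω (ε * N)) ∧
        -- there is a forward invariant set between `Ω_{εM}` and `Ω_{εN}`
        (∃ V, S.tube Ω (ε * M) ⊆ V ∧ V ⊆ S.tube Ω (ε * N) ∧ IsForwardInvariantSet (S.field ε) V) ∧
        -- in `Ω_{εN}` the slow dynamics is an `O(ε)` perturbation of the reduced system
        (∀ z ∈ S.tube Ω (ε * N), ‖S.slowField ε z - S.reducedField z.2‖ ≤ K * ε) := by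
  obtain ⟨M, N, K, hM, hMN, hev⟩ := S.exists_tube_trapping hε₁ hS hstable hΩ
  obtain ⟨u, hu, hsub⟩ := mem_nhdsGT_iff_exists_Ioo_subset.1 hev
  refine ⟨M, N, min u ε₁, K, hM, hMN, lt_min hu hε₁, min_le_right _ _, fun ε hε hεu => ?_⟩
  obtain ⟨htrap, hclose⟩ := hsub ⟨hε, hεu.trans_le (min_le_left _ _)⟩
  obtain ⟨L, hL⟩ := S.exists_lipschitzWith_field ε
  refine ⟨fun z₀ _ => hL.exists_isForwardOrbit z₀, htrap,
    -- `V` is the union of all forward orbits from the smaller tube; uniqueness makes it invariant.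
    ⟨{p | ∃ z, IsForwardOrbit (S.field ε) z ∧ z 0 ∈ S.tube Ω (ε * M) ∧ ∃ t, 0 ≤ t ∧ z t = p},
      fun p hp => ?_, ?_, ?_⟩, hclose⟩
  · obtain ⟨z, hz, rfl⟩ := hL.exists_isForwardOrbit p
    exact ⟨z, hz, hp, 0, le_rfl, rfl⟩
  · rintro _ ⟨z, hz, hz0, t, ht, rfl⟩
    exact htrap z hz hz0 t ht
  · rintro w hw ⟨z, hz, hz0, t, ht, hzt⟩ s hs
    exact ⟨z, hz, hz0, t + s, add_nonneg ht hs,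
      (hw.eq_of_eq hL (hz.shift ht) (by rw [add_zero, hzt]) hs).symm⟩
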